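/- **Proposition (Energy evolution).** Let $(M,g_0)$ be a closed smooth Riemannian $3$-manifold with a smooth global $g_0$-orthonormal frame $E_1,E_2,E_3$, and let its spinor bundle be trivialized by this frame, so that spinor fields are maps $M\to\mathbb C^2$ and $E_k$ acts by Clifford multiplication through matrices $\gamma_k=i\sigma_k$ ($\sigma_k$ the Pauli matrices), $\gamma_i\gamma_j+\gamma_j\gamma_i=-2\delta_{ij}$. For a nowhere vanishing spinor field $\psi$ put $\rho=|\psi|$, $g(\psi)=\rho^2g_0$, with orthonormal frame $e_k=\rho^{-1}E_k$; spinors of $g_0$ and $g(\psi)$ with the same components in these frames are identified. Let $dV_{g(\psi)}$ be the Riemannian volume measure and $$D_{g(\psi)}\varphi=\sum_k\gamma_k\nabla_{e_k}\varphi,\qquad \nabla_{e_k}\varphi=e_k(\varphi)+\tfrac14\sum_{i,j}g(\nabla^{g}_{e_k}e_i,e_j)\,\gamma_i\gamma_j\varphi ,\qquad g=g(\psi),$$ the Dirac operator of $g(\psi)$, where $\nabla^g$ is the Levi-Civita connection. Put $E[\psi]=\int_M|D_{g(\psi)}\psi|^2\,dV_{g(\psi)}$. Let $\psi$ be a smooth,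 nowhere vanishing solution of $\partial_t\psi=-D_{g(\psi)}^2\psi$ on $M\times(0,T)$. Then for every $t\in(0,T)$, with $g=g(\psi(t))$, $D=D_{g(\psi(t))}$ and $h=\partial_tg(\psi(t))$, the energy is differentiable at $t$, all integrals below converge absolutely, and $$\frac{d}{dt}E[\psi(t)]=-2\int_M|D^2\psi|^2\,dV_g+\mathcal R(\psi,\partial_tg),$$ $$\mathcal R(\psi,h)=2\int_M\operatorname{Re}\langle\dot D_h\psi,D\psi\rangle\,dV_g+\int_M\tfrac12(\operatorname{tr}_gh)\,|D\psi|^2\,dV_g,$$ where $\dot D_h\varphi=\tfrac16\big(\operatorname{grad}_g(\operatorname{tr}_gh)\cdot\varphi-(\operatorname{tr}_gh)\,D\varphi\big)$ and $\cdot$ is Clifford multiplication for $g$. The two terms of $\mathcal R$ are those that come from the time dependence of the metric in the Dirac operator and of the volume form: the metric varies conformally, $h=\tfrac13(\operatorname{tr}_gh)\,g$; for every smooth spinor field $\varphi$ independent of time, $\partial_t\big(D_{g(\psi(t))}\varphi\big)=\dot D_h\varphi$ pointwise; and $\partial_t\,dV_{g(\psi(t))}=\tfrac12(\operatorname{tr}_gh)\,dV_g$,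 i.e. $\frac{d}{dt}\operatorname{vol}_{g(\psi(t))}(A)=\int_A\tfrac12(\operatorname{tr}_gh)\,dV_g$ for every Borel set $A\subseteq M$. -/

import Mathlib

open Set MeasureTheory
open scoped Manifold ContDiff

noncomputable section

namespace SpinorFlow

/-- The model space of a 3-manifold. -/
abbrev Model : Type := EuclideanSpace ℝ (Fin 3)

/-- The fibre `ℂ²` of the trivialized spinor bundle, with its Hermitian norm. -/
abbrev Spinor : Type := EuclideanSpace ℂ (Fin 2)

/-! ### Clifford multiplication -/

/-- The matrices `i σ₁, i σ₂, i σ₃` (`σₖ` the Pauli matrices). -/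
def gamma : Fin 3 → Matrix (Fin 2) (Fin 2) ℂ :=
  ![!![0, Complex.I; Complex.I, 0], !![0, 1; -1, 0], !![Complex.I, 0; 0, -Complex.I]]

/-- Clifford multiplication by the `k`-th vector of an orthonormal frame. -/
def clifford (k : Fin 3) : Spinor →L[ℂ] Spinor :=
  Matrix.toEuclideanCLM (n := Fin 2) (𝕜 := ℂ) (gamma k)

/-- The Clifford relations `γᵢ γⱼ + γⱼ γᵢ = -2 δᵢⱼ`. -/
theorem gamma_relations (i j : Fin 3) :
    gamma i * gamma j + gamma j * gamma i = if i = j then -2 else 0 := by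
  fin_cases i <;> fin_cases j <;> ext a b <;> fin_cases a <;> fin_cases b <;>
    simp [gamma, ← Matrix.diagonal_ofNat'] <;> norm_num

/-- Clifford multiplication by a vector is skew-Hermitian. -/
theorem gamma_conjTranspose (i : Fin 3) : (gamma i).conjTranspose = -gamma i := by
  fin_cases i <;> ext a b <;> fin_cases a <;> fin_cases b <;> simp [gamma]

/-! ### Riemannian geometry -/

section Geometry

variable {M : Type*} [TopologicalSpace M] [ChartedSpace Model M]

/-- Fields of bilinear forms on the tangent spaces; a Riemannian metric is such a field. -/
abbrev FormField (M : Type*) [TopologicalSpace M] [ChartedSpace Model M] : Type _ :=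
  ∀ x : M, TangentSpace (𝓡 3) x →L[ℝ] TangentSpace (𝓡 3) x →L[ℝ] ℝ

/-- Vector fields on `M`. -/
abbrev VField (M : Type*) [TopologicalSpace M] [ChartedSpace Model M] : Type _ :=
  ∀ x : M, TangentSpace (𝓡 3) x

/-- `g(∇_X Y, Z)` at `x` for the Levi-Civita connection `∇` of `g` (Koszul formula). -/
def leviCivita (g : FormField M) (X Y Z : VField M) (x : M) : ℝ :=
  (1 / 2) *
    (mvfderiv (𝓡 3) (fun y => g y (Y y) (Z y)) x (X x)
      + mvfderiv (𝓡 3) (fun y => g y (Z y) (X y)) x (Y x)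
      - mvfderiv (𝓡 3) (fun y => g y (X y) (Y y)) x (Z x)
      + g x (VectorField.mlieBracket (𝓡 3) X Y x) (Z x)
      - g x (VectorField.mlieBracket (𝓡 3) Y Z x) (X x)
      + g x (VectorField.mlieBracket (𝓡 3) Z X x) (Y x))

/-- The density `√det (g(∂ᵢ, ∂ⱼ))` of `g` in the preferred chart at `c`, at the point with
coordinates `y`. -/
def chartDensity (g : FormField M) (c : M) (y : Model) : ℝ :=
  let d : Fin 3 → TangentSpace (𝓡 3) ((extChartAt (𝓡 3) c).symm y) := fun i =>
    mfderiv 𝓘(ℝ, Model) (𝓡 3) (extChartAt (𝓡 3) c).symm y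
      (EuclideanSpace.single i (1 : ℝ) : Model)
  √(Matrix.det (Matrix.of fun i j : Fin 3 => g ((extChartAt (𝓡 3) c).symm y) (d i) (d j)))

/-- The Riemannian volume of `g` on the domain of the preferred chart at `c`, extended by zero:
Lebesgue measure with density `√det g`, transported to `M`. -/
def chartVolume [MeasurableSpace M] (g : FormField M) (c : M) : Measure M :=
  Measure.map (extChartAt (𝓡 3) c).symm
    ((volume.restrict (extChartAt (𝓡 3) c).target).withDensity
      fun y => ENNReal.ofReal (chartDensity g c y))

/-- The Riemannian volume measure `dV_g`. The measures `chartVolume g c` are the restrictions of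
`dV_g` to the chart domains, so that `dV_g` is their least upper bound. -/
def volumeMeasure [MeasurableSpace M] (g : FormField M) : Measure M :=
  ⨆ c : M, chartVolume g c

/-! ### The Dirac operator

`e` is a global `g`-orthonormal frame; it trivializes the spinor bundle of `(M, g)`, and spinor
fields are maps `M → ℂ²`. -/

/-- The spinorial Levi-Civita derivative
`∇_{eₖ} φ = eₖ(φ) + ¼ ∑ᵢⱼ g(∇_{eₖ} eᵢ, eⱼ) γᵢ γⱼ φ`. -/
def spinDeriv (g : FormField M) (e : Fin 3 → VField M) (k : Fin 3) (φ : M → Spinor) (x : M) :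
    Spinor :=
  mvfderiv (𝓡 3) φ x (e k x) +
    (1 / 4 : ℝ) • ∑ i, ∑ j, leviCivita g (e k) (e i) (e j) x • clifford i (clifford j (φ x))

/-- The Dirac operator `D φ = ∑ₖ eₖ · ∇_{eₖ} φ`. -/
def dirac (g : FormField M) (e : Fin 3 → VField M) (φ : M → Spinor) (x : M) : Spinor :=
  ∑ k, clifford k (spinDeriv g e k φ x)

/-! ### The geometry induced by a spinor field -/

/-- The metric `g(ψ) = ρ² g₀`, `ρ = |ψ|`. -/
def inducedMetric (g₀ : FormField M) (ψ : M → Spinor) : FormField M :=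
  fun x => (‖ψ x‖ ^ 2) • g₀ x

/-- The `g(ψ)`-orthonormal frame `ρ⁻¹ Eₖ` obtained from a `g₀`-orthonormal frame `E`. Spinors of
`g₀` and of `g(ψ)` with the same components in the two frames are identified. -/
def inducedFrame (E : Fin 3 → VField M) (ψ : M → Spinor) : Fin 3 → VField M :=
  fun k x => ‖ψ x‖⁻¹ • E k x

/-- The Dirac operator `D_{g(ψ)}`. -/
def inducedDirac (g₀ : FormField M) (E : Fin 3 → VField M) (ψ φ : M → Spinor) : M → Spinor :=
  dirac (inducedMetric g₀ ψ) (inducedFrame E ψ) φ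

/-- The volume measure `dV_{g(ψ)}`. -/
def inducedVolume [MeasurableSpace M] (g₀ : FormField M) (ψ : M → Spinor) : Measure M :=
  volumeMeasure (inducedMetric g₀ ψ)

/-- The energy `E[ψ] = ∫ |D_{g(ψ)} ψ|² dV_{g(ψ)}`. -/
def energy [MeasurableSpace M] (g₀ : FormField M) (E : Fin 3 → VField M) (ψ : M → Spinor) : ℝ :=
  ∫ x, ‖inducedDirac g₀ E ψ ψ x‖ ^ 2 ∂(inducedVolume g₀ ψ)

/-- The velocity `∂ₜ g` of the metric `g(ψ(t))`, at time `t`. -/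
def metricVelocity (g₀ : FormField M) (ψ : ℝ → M → Spinor) (t : ℝ) (x : M)
    (v w : TangentSpace (𝓡 3) x) : ℝ :=
  deriv (fun s => inducedMetric g₀ (ψ s) x v w) t

/-! ### The reaction term -/

/-- The trace `∑ₖ h(eₖ, eₖ)` of a field of bilinear forms. -/
def frameTrace (e : Fin 3 → VField M)
    (h : ∀ x : M, TangentSpace (𝓡 3) x → TangentSpace (𝓡 3) x → ℝ) (x : M) : ℝ :=
  ∑ k, h x (e k x) (e k x)

/-- The first variation of the Dirac operator along a conformal variation `h = (tr_g h / 3) g` of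
the metric: `Ḋ_h φ = ⅙ (grad_g (tr_g h) · φ - (tr_g h) D φ)`. -/
def diracVariation (g : FormField M) (e : Fin 3 → VField M)
    (h : ∀ x : M, TangentSpace (𝓡 3) x → TangentSpace (𝓡 3) x → ℝ) (φ : M → Spinor) (x : M) :
    Spinor :=
  (1 / 6 : ℝ) •
    ((∑ k, mvfderiv (𝓡 3) (frameTrace e h) x (e k x) • clifford k (φ x))
      - frameTrace e h x • dirac g e φ x)

/-- The part of `R(φ, h)` due to the variation of the Dirac operator with the metric,
`2 Re ⟨Ḋ_h φ, D φ⟩`, as a density with respect to `dV_g`. -/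
def metricReaction (g : FormField M) (e : Fin 3 → VField M)
    (h : ∀ x : M, TangentSpace (𝓡 3) x → TangentSpace (𝓡 3) x → ℝ) (φ : M → Spinor) (x : M) : ℝ :=
  2 * (inner ℂ (diracVariation g e h φ x) (dirac g e φ x)).re

/-- The part of `R(φ, h)` due to the variation `½ (tr_g h) dV_g` of the volume form,
`½ (tr_g h) |D φ|²`, as a density with respect to `dV_g`. -/
def volumeReaction (g : FormField M) (e : Fin 3 → VField M)
    (h : ∀ x : M, TangentSpace (𝓡 3) x → TangentSpace (𝓡 3) x → ℝ) (φ : M → Spinor) (x : M) : ℝ :=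
  (1 / 2) * frameTrace e h x * ‖dirac g e φ x‖ ^ 2

/-- The reaction term `R(φ, h)`. -/
def reaction [MeasurableSpace M] (g : FormField M) (e : Fin 3 → VField M)
    (h : ∀ x : M, TangentSpace (𝓡 3) x → TangentSpace (𝓡 3) x → ℝ) (φ : M → Spinor) : ℝ :=
  (∫ x, metricReaction g e h φ x ∂(volumeMeasure g))
    + ∫ x, volumeReaction g e h φ x ∂(volumeMeasure g)

end Geometry

end SpinorFlow

end

set_option linter.unusedSectionVars false

noncomputable section
namespace SpinorFlow

/-! ### Clifford algebra -/

/-! Everything is transported to the fixed background. Put `l = ρ⁻¹`. In dimension three the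
conformal change of metric gives `D_{g(ψ)} φ = l D₀ φ - ∑ Eₖ(l) γₖ φ` (`dirac_conformal`; the right
side is `conformalDirac`, written `D_l φ` here) and `dV_{g(ψ)} = ρ³ dV₀`
(`volumeMeasure_conformal`). So the energy is `∫ ρ³ |D_l ψ|² dV₀`, an integral against a fixed
finite measure, and on a closed manifold it may be differentiated under the integral sign
(`SmoothFamily.hasDerivAt_integral`).

Since `D_l φ` is linear in `l` and in `φ`, the product rule yields three terms. The derivative of
`ρ³` is the volume reaction, because `tr h = 6 ρ'/ρ`. The derivative of `l` produces `D_{l'} ψ`,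
which is `Ḋ_h ψ` (`diracVariation_eq`). The last term, `2 ∫ ρ³ Re⟨D_l ∂ₜψ, D_l ψ⟩ dV₀`, becomes `-2
∫ |D²ψ|² dV` by the flow equation, once `D_l` is known to be symmetric for `ρ³ dV₀`.

Conformal covariance, `D_l u = l² D₀(l⁻¹ u)`, reduces that symmetry to the symmetry of `D₀`. For
`D₀`, the difference of the two pairings is `∑ₖ (Eₖ fₖ + (div Eₖ) fₖ)` with `fₖ = Re⟨γₖ u, v⟩`
(`re_inner_dirac_sub`): the zeroth order term, built from the structure functions of the frame,
fails to be symmetric by exactly the divergences of the frame (`re_inner_connection_sub`). This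
integrates to zero by the divergence theorem, proved in charts with a partition of unity; there the
Riemannian density is the inverse of the frame determinant, and its derivative is computed from the
brackets (`fderiv_density_add`). As the volume is a supremum of chart measures, it must also be
shown to restrict to each of them (`volumeMeasure_apply_of_subset`). -/

theorem clifford_zero_apply (v : Spinor) :
    clifford 0 v = WithLp.toLp 2 ![Complex.I * v 1, Complex.I * v 0] := by
  ext i; fin_cases i <;> simp [clifford, gamma, Matrix.vecHead, Matrix.vecTail]

theorem clifford_one_apply (v : Spinor) :
    clifford 1 v = WithLp.toLp 2 ![v 1, -v 0] := by
  ext i; fin_cases i <;> simp [clifford, gamma, Matrix.vecHead, Matrix.vecTail]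

theorem clifford_two_apply (v : Spinor) :
    clifford 2 v = WithLp.toLp 2 ![Complex.I * v 0, -(Complex.I * v 1)] := by
  ext i; fin_cases i <;> simp [clifford, gamma, Matrix.vecHead, Matrix.vecTail]

theorem clifford_real_smul (k : Fin 3) (r : ℝ) (v : Spinor) :
    clifford k (r • v) = r • clifford k v :=
  (clifford k).map_smul_of_tower r v

/-- Clifford multiplication is skew-Hermitian. -/
theorem re_inner_clifford_left (k : Fin 3) (u v : Spinor) :
    (inner ℂ (clifford k u) v).re = -(inner ℂ u (clifford k v)).re := by
  fin_cases k <;>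
  simp [clifford_zero_apply, clifford_one_apply, clifford_two_apply, PiLp.inner_apply] <;> ring

/-- The Clifford contraction appearing in the conformal change of the Dirac operator. -/
theorem sum_clifford_conformal (a : Fin 3 → ℝ) (v : Spinor) :
    (1 / 4 : ℝ) • ∑ k, ∑ i, ∑ j, ((if i = k then a j else 0) - (if j = k then a i else 0)) •
      clifford k (clifford i (clifford j v)) = -∑ k, a k • clifford k v := by
  -- Since `∑ γₖγₖ = -3` and `∑ₖ γₖγᵢγₖ = γᵢ` in dimension three, the coefficient is `(-3 - 1)/4 =
  -- -1`; this is checked on components.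
  ext i
  fin_cases i <;>
  simp [Fin.sum_univ_three, clifford_zero_apply, clifford_one_apply, clifford_two_apply,
    Complex.ext_iff] <;> constructor <;> ring

/-- The connection coefficients of an orthonormal frame with structure functions `c`. -/
def koszulCoeff (c : Fin 3 → Fin 3 → Fin 3 → ℝ) (k i j : Fin 3) : ℝ :=
  (1 / 2) * (c k i j - c i j k + c j k i)

/-- The zeroth order part of the Dirac operator fails to be symmetric by the Clifford product
with the divergences of the frame. -/
theorem re_inner_connection_sub (c : Fin 3 → Fin 3 → Fin 3 → ℝ)
    (hc : ∀ i j k, c i j k = -c j i k) (u v : Spinor) :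
    (inner ℂ ((1 / 4 : ℝ) • ∑ k, ∑ i, ∑ j, koszulCoeff c k i j •
        clifford k (clifford i (clifford j u))) v).re
      - (inner ℂ u ((1 / 4 : ℝ) • ∑ k, ∑ i, ∑ j, koszulCoeff c k i j •
        clifford k (clifford i (clifford j v)))).re
      = ∑ k, (∑ i, c i k i) * (inner ℂ (clifford k u) v).re := by
  -- Antisymmetry leaves nine independent structure functions. The totally antisymmetric part of the
  -- coefficients multiplies `γ₀γ₁γ₂ = 1`, which is Hermitian and drops out of the difference.
  have h0 : ∀ i k, c i i k = 0 := fun i k => by linarith [hc i i k]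
  simp only [koszulCoeff, Fin.sum_univ_three, h0, hc 1 0, hc 2 0, hc 2 1]
  simp [clifford_zero_apply, clifford_one_apply, clifford_two_apply, PiLp.inner_apply]

  ring

/-! ### Differential calculus on manifolds -/

section Calculus

variable {F G : Type*} [NormedAddCommGroup F] [NormedSpace ℝ F]
  [NormedAddCommGroup G] [NormedSpace ℝ G]

/-- Directional derivatives of a smooth family of functions along a smooth family of tangent
vectors depend smoothly on the parameter. -/
theorem contMDiffAt_mvfderiv_apply
    {EN HN : Type*} [NormedAddCommGroup EN] [NormedSpace ℝ EN] [TopologicalSpace HN]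
    {J : ModelWithCorners ℝ EN HN} {N : Type*} [TopologicalSpace N] [ChartedSpace HN N]
    [IsManifold J ∞ N]
    {EM HM : Type*} [NormedAddCommGroup EM] [NormedSpace ℝ EM] [TopologicalSpace HM]
    {I : ModelWithCorners ℝ EM HM} {M : Type*} [TopologicalSpace M] [ChartedSpace HM M]
    [IsManifold I ∞ M] {f : N → M → F} {b : N → M} {V : ∀ n, TangentSpace I (b n)} {n₀ : N}
    (hf : ContMDiffAt (J.prod I) 𝓘(ℝ, F) ∞ (Function.uncurry f) (n₀, b n₀))
    (hV : ContMDiffAt J I.tangent ∞ (fun n => (⟨b n, V n⟩ : TangentBundle I M)) n₀) :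
    ContMDiffAt J 𝓘(ℝ, F) ∞ (fun n => mvfderiv I (f n) (b n) (V n)) n₀ := by
  have : IsManifold I 1 M := IsManifold.of_le (n := ∞) (by simp)
  have : IsManifold J 1 N := IsManifold.of_le (n := ∞) (by simp)
  have hb : ContMDiffAt J I ∞ b n₀ := (Bundle.contMDiffAt_totalSpace.1 hV).1
  have hφ := hf.mfderiv f b hb (m := ∞) (by simp)
  have hb₂ : ContMDiffAt J 𝓘(ℝ, F) ∞ (fun n => f n (b n)) n₀ :=
    ContMDiffAt.comp n₀ hf (contMDiffAt_id.prodMk hb)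
  have key := ContMDiffWithinAt.clm_apply_of_inCoordinates (s := univ)
    (ϕ := fun n => mfderiv I 𝓘(ℝ, F) (f n) (b n)) hφ hV hb₂
  -- `key` gives smoothness into the tangent bundle of `F`; the vector is recovered by the second
  -- projection.
  exact (contMDiff_snd_tangentBundle_modelSpace F 𝓘(ℝ, F)).contMDiffAt.comp n₀ key

variable {M : Type*} [TopologicalSpace M] [ChartedSpace Model M]

theorem mvfderiv_comp_hasFDerivAt {f : M → F} {L : F → G} {L' : F →L[ℝ] G} {x : M}
    (hL : HasFDerivAt L L' (f x)) (hf : MDifferentiableAt (𝓡 3) 𝓘(ℝ, F) f x)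
    (v : TangentSpace (𝓡 3) x) :
    mvfderiv (𝓡 3) (fun y => L (f y)) x v = L' (mvfderiv (𝓡 3) f x v) := by
  have h := (HasMFDerivAt.comp x hL.hasMFDerivAt hf.hasMFDerivAt).mfderiv
  exact congrArg (fun A => A v) h

theorem mvfderiv_eq_fderiv {f : M → F} {x : M} (hf : MDifferentiableAt (𝓡 3) 𝓘(ℝ, F) f x)
    (v : TangentSpace (𝓡 3) x) :
    mvfderiv (𝓡 3) f x v =
      fderiv ℝ (fun y => f ((extChartAt (𝓡 3) x).symm y)) (extChartAt (𝓡 3) x x) v := by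
  rw [hf.mvfderiv]
  have : range (𝓡 3) = univ := by simp
  rw [this, fderivWithin_univ]
  rfl

theorem mvfderiv_congr {f g : M → F} {x : M} (h : f =ᶠ[nhds x] g)
    (v : TangentSpace (𝓡 3) x) : mvfderiv (𝓡 3) f x v = mvfderiv (𝓡 3) g x v := by
  have := h.mfderiv_eq (I := 𝓡 3) (I' := 𝓘(ℝ, F))
  exact congrArg (fun A => A v) this

/-- A family of functions on `M`, depending smoothly on time `t ∈ (0, T)`. -/
def SmoothFamily (T : ℝ) (f : ℝ → M → F) : Prop :=
  ContMDiffOn (𝓘(ℝ, ℝ).prod (𝓡 3)) 𝓘(ℝ, F) ∞ (fun p : ℝ × M => f p.1 p.2) (Ioo 0 T ×ˢ univ)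

namespace SmoothFamily

variable {T : ℝ} {f : ℝ → M → F} {g : ℝ → M → G} {t : ℝ}

theorem contMDiffAt (hf : SmoothFamily T f) (ht : t ∈ Ioo 0 T) (x : M) :
    ContMDiffAt (𝓘(ℝ, ℝ).prod (𝓡 3)) 𝓘(ℝ, F) ∞ (fun p : ℝ × M => f p.1 p.2) (t, x) :=
  ContMDiffOn.contMDiffAt hf ((isOpen_Ioo.prod isOpen_univ).mem_nhds ⟨ht, mem_univ _⟩)

theorem of_contMDiffAt (h : ∀ t ∈ Ioo 0 T, ∀ x,
    ContMDiffAt (𝓘(ℝ, ℝ).prod (𝓡 3)) 𝓘(ℝ, F) ∞ (fun p : ℝ × M => f p.1 p.2) (t, x)) :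
    SmoothFamily T f :=
  fun p hp => (h p.1 hp.1 p.2).contMDiffWithinAt

theorem slice (hf : SmoothFamily T f) (ht : t ∈ Ioo 0 T) :
    ContMDiff (𝓡 3) 𝓘(ℝ, F) ∞ (f t) := fun x =>
  (hf.contMDiffAt ht x).comp x (f := fun y : M => (t, y))
    (contMDiffAt_const.prodMk contMDiffAt_id)

theorem mdifferentiableAt (hf : SmoothFamily T f) (ht : t ∈ Ioo 0 T) (x : M) :
    MDifferentiableAt (𝓡 3) 𝓘(ℝ, F) (f t) x :=
  (hf.slice ht).mdifferentiableAt (by simp)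

theorem contDiffAt_time (hf : SmoothFamily T f) (ht : t ∈ Ioo 0 T) (x : M) :
    ContDiffAt ℝ ∞ (fun s => f s x) t :=
  ((hf.contMDiffAt ht x).comp t (f := fun s : ℝ => (s, x))
    (contMDiffAt_id.prodMk contMDiffAt_const)).contDiffAt

theorem hasDerivAt (hf : SmoothFamily T f) (ht : t ∈ Ioo 0 T) (x : M) :
    HasDerivAt (fun s => f s x) (deriv (fun s => f s x) t) t :=
  ((hf.contDiffAt_time ht x).differentiableAt (by simp)).hasDerivAt

theorem continuousOn (hf : SmoothFamily T f) :
    ContinuousOn (fun p : ℝ × M => f p.1 p.2) (Ioo 0 T ×ˢ univ) :=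
  ContMDiffOn.continuousOn hf

theorem continuous_slice (hf : SmoothFamily T f) (ht : t ∈ Ioo 0 T) : Continuous (f t) :=
  (hf.slice ht).continuous

theorem const_time {φ : M → F} (hφ : ContMDiff (𝓡 3) 𝓘(ℝ, F) ∞ φ) :
    SmoothFamily T (fun _ => φ) :=
  (hφ.comp contMDiff_snd).contMDiffOn

theorem prodMk (hf : SmoothFamily T f) (hg : SmoothFamily T g) :
    SmoothFamily T (fun s x => (f s x, g s x)) :=
  of_contMDiffAt fun _ ht x => (hf.contMDiffAt ht x).prodMk_space (hg.contMDiffAt ht x)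

theorem comp {L : F → G} (hf : SmoothFamily T f)
    (hL : ∀ t ∈ Ioo 0 T, ∀ x, ContDiffAt ℝ ∞ L (f t x)) :
    SmoothFamily T (fun s x => L (f s x)) :=
  of_contMDiffAt fun t ht x =>
    ContMDiffAt.comp (t, x) (g := L) (f := fun p : ℝ × M => f p.1 p.2) (hL t ht x).contMDiffAt
      (hf.contMDiffAt ht x)

/-- The time derivative is the derivative along the constant field `1` on `ℝ`, with the point of `M`
as an additional parameter. -/
theorem deriv [IsManifold (𝓡 3) ∞ M] (hf : SmoothFamily T f) :
    SmoothFamily T (fun s x => deriv (fun τ => f τ x) s) := by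
  refine of_contMDiffAt fun t ht x => ?_
  have h := contMDiffAt_mvfderiv_apply (I := 𝓘(ℝ, ℝ)) (J := 𝓘(ℝ, ℝ).prod (𝓡 3))
    (f := fun (p : ℝ × M) (τ : ℝ) => f τ p.2) (b := fun p => p.1) (V := fun _ => (1 : ℝ))
    (n₀ := (t, x)) ?_ ?_
  · refine h.congr_of_eventuallyEq (Filter.Eventually.of_forall fun p => ?_)
    change _ = mfderiv 𝓘(ℝ, ℝ) 𝓘(ℝ, F) (fun τ => f τ p.2) p.1 (1 : ℝ)
    rw [mfderiv_eq_fderiv]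
    rfl
  · exact ContMDiffAt.comp ((t, x), t) (g := fun p : ℝ × M => f p.1 p.2)
      (f := fun q : (ℝ × M) × ℝ => (q.2, q.1.2)) (hf.contMDiffAt ht x)
      (contMDiffAt_snd.prodMk
        ((contMDiff_snd (I := 𝓘(ℝ, ℝ)) (J := 𝓡 3)).comp contMDiff_fst).contMDiffAt)
  · have h1 : ContMDiff 𝓘(ℝ, ℝ) 𝓘(ℝ, ℝ).tangent ∞
        (fun s : ℝ => (⟨s, (1 : ℝ)⟩ : TangentBundle 𝓘(ℝ, ℝ) ℝ)) := fun s =>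
      contMDiffAt_vectorSpace_iff_contDiffAt.2 contDiffAt_const
    exact (h1 t).comp (t, x) (contMDiffAt_fst (I := 𝓘(ℝ, ℝ)) (J := 𝓡 3))

theorem mvfderiv [IsManifold (𝓡 3) ∞ M] (hf : SmoothFamily T f) {X : VField M}
    (hX : ContMDiff (𝓡 3) ((𝓡 3).prod 𝓘(ℝ, Model)) ∞
      (fun x => (⟨x, X x⟩ : TangentBundle (𝓡 3) M))) :
    SmoothFamily T (fun s x => mvfderiv (𝓡 3) (f s) x (X x)) := by
  refine of_contMDiffAt fun t ht x => ?_
  refine contMDiffAt_mvfderiv_apply (I := 𝓡 3) (J := 𝓘(ℝ, ℝ).prod (𝓡 3))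
    (f := fun (p : ℝ × M) (y : M) => f p.1 y) (b := fun p => p.2) (V := fun p => X p.2)
    (n₀ := (t, x)) ?_ ?_
  · exact ContMDiffAt.comp ((t, x), x) (g := fun p : ℝ × M => f p.1 p.2)
      (f := fun q : (ℝ × M) × M => (q.1.1, q.2)) (hf.contMDiffAt ht x)
      (((contMDiff_fst (I := 𝓘(ℝ, ℝ)) (J := 𝓡 3)).comp contMDiff_fst).contMDiffAt.prodMk
        contMDiffAt_snd)
  · exact (hX x).comp (t, x) (contMDiffAt_snd (I := 𝓘(ℝ, ℝ)) (J := 𝓡 3))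

/-- Time derivatives and directional derivatives commute. -/
theorem hasDerivAt_mvfderiv [IsManifold (𝓡 3) ∞ M] (hf : SmoothFamily T f) (ht : t ∈ Ioo 0 T)
    (x : M) (v : TangentSpace (𝓡 3) x) :
    HasDerivAt (fun s => _root_.mvfderiv (𝓡 3) (f s) x v)
      (_root_.mvfderiv (𝓡 3) (fun y => _root_.deriv (fun s => f s y) t) x v) t := by
  set y₀ : Model := extChartAt (𝓡 3) x x with hy₀
  -- In the chart at `x` both sides become mixed second derivatives of `K`, taken in opposite
  -- orders, and the symmetry `hsym` identifies them.
  set K : ℝ × Model → F := fun p => f p.1 ((extChartAt (𝓡 3) x).symm p.2) with hK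
  have hx₀ : (extChartAt (𝓡 3) x).symm y₀ = x := extChartAt_to_inv x
  have hsymm : ContMDiffAt 𝓘(ℝ, Model) (𝓡 3) ∞ (extChartAt (𝓡 3) x).symm y₀ :=
    (contMDiffOn_extChartAt_symm x).contMDiffAt (extChartAt_target_mem_nhds x)
  have hKsm : ∀ s ∈ Ioo 0 T, ContDiffAt ℝ ∞ K (s, y₀) := by
    intro s hs
    have h1 : ContMDiffAt (𝓘(ℝ, ℝ).prod (𝓡 3)) 𝓘(ℝ, F) ∞ (fun p : ℝ × M => f p.1 p.2)
        (s, (extChartAt (𝓡 3) x).symm y₀) := hf.contMDiffAt hs _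
    have h2 : ContMDiffAt (𝓘(ℝ, ℝ).prod 𝓘(ℝ, Model)) (𝓘(ℝ, ℝ).prod (𝓡 3)) ∞
        (fun p : ℝ × Model => (p.1, (extChartAt (𝓡 3) x).symm p.2)) (s, y₀) :=
      contMDiffAt_fst.prodMk (ContMDiffAt.comp (s, y₀) hsymm contMDiffAt_snd)
    have h3 := ContMDiffAt.comp (s, y₀) h1 h2
    rw [← modelWithCornersSelf_prod, chartedSpaceSelf_prod] at h3
    exact h3.contDiffAt
  have hspace : ∀ s ∈ Ioo 0 T, _root_.mvfderiv (𝓡 3) (f s) x v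
      = fderiv ℝ K (s, y₀) ((0 : ℝ), v) := by
    intro s hs
    rw [mvfderiv_eq_fderiv (hf.mdifferentiableAt hs x)]
    have h1 : HasFDerivAt (fun y => (s, y)) (ContinuousLinearMap.inr ℝ ℝ Model) y₀ :=
      hasFDerivAt_prodMk_right s y₀
    have h2 := ((hKsm s hs).differentiableAt (by simp)).hasFDerivAt.comp y₀ h1
    have h3 := h2.fderiv
    exact congrArg (fun A : Model →L[ℝ] F => A v) h3
  have hcd := hKsm t ht
  have hnear : ∀ᶠ y in nhds y₀, DifferentiableAt ℝ K (t, y) := by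
    have h1 : ∀ᶠ q in nhds (t, y₀), DifferentiableAt ℝ K q :=
      ((hcd.of_le (m := 1) (by simp)).eventually (by simp)).mono
        fun q hq => hq.differentiableAt (by simp)
    exact (Continuous.prodMk_right t).continuousAt.eventually h1
  have htime : ∀ᶠ y in nhds y₀,
      _root_.deriv (fun s => f s ((extChartAt (𝓡 3) x).symm y)) t
        = fderiv ℝ K (t, y) ((1 : ℝ), (0 : Model)) := by
    filter_upwards [hnear] with y hy
    have h1 : HasDerivAt (fun s : ℝ => (s, y)) ((1 : ℝ), (0 : Model)) t :=
      (hasDerivAt_id t).prodMk (hasDerivAt_const t y)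
    exact (hy.hasFDerivAt.comp_hasDerivAt t h1).deriv
  have hd2 : DifferentiableAt ℝ (fderiv ℝ K) (t, y₀) :=
    (hcd.fderiv_right (m := 1) (by norm_num; exact WithTop.coe_le_coe.2 le_top)).differentiableAt (by simp)
  have hsym : IsSymmSndFDerivAt ℝ K (t, y₀) := hcd.isSymmSndFDerivAt (by simp; exact WithTop.coe_le_coe.2 le_top)
  have hlhs : HasDerivAt (fun s => fderiv ℝ K (s, y₀) ((0 : ℝ), v))
      (fderiv ℝ (fderiv ℝ K) (t, y₀) ((1 : ℝ), (0 : Model)) ((0 : ℝ), v)) t := by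
    have h1 : HasDerivAt (fun s : ℝ => (s, y₀)) ((1 : ℝ), (0 : Model)) t :=
      (hasDerivAt_id t).prodMk (hasDerivAt_const t y₀)
    have h2 := hd2.hasFDerivAt.comp_hasDerivAt t h1
    exact h2.clm_apply (hasDerivAt_const t _) |>.congr_deriv (by simp)
  have hrhs : _root_.mvfderiv (𝓡 3) (fun y => _root_.deriv (fun s => f s y) t) x v
      = fderiv ℝ (fderiv ℝ K) (t, y₀) ((0 : ℝ), v) ((1 : ℝ), (0 : Model)) := by
    rw [mvfderiv_eq_fderiv (hf.deriv.mdifferentiableAt ht x)]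
    have h1 : HasFDerivAt (fun y => (t, y)) (ContinuousLinearMap.inr ℝ ℝ Model) y₀ :=
      hasFDerivAt_prodMk_right t y₀
    have h2 := (hd2.hasFDerivAt.comp y₀ h1).clm_apply
      (hasFDerivAt_const ((1 : ℝ), (0 : Model)) y₀)
    have h3 := (h2.congr_of_eventuallyEq htime).fderiv
    have h4 := congrArg (fun A : Model →L[ℝ] F => A v) h3
    refine h4.trans ?_
    simp
    rfl
  rw [hrhs, hsym.eq]
  refine hlhs.congr_of_eventuallyEq ?_
  filter_upwards [isOpen_Ioo.mem_nhds ht] with s hs using hspace s hs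

end SmoothFamily

end Calculus

/-! ### The Dirac operator in an orthonormal frame -/

section Frame

variable {M : Type*} [TopologicalSpace M] [ChartedSpace Model M]

/-- The structure functions `g([eᵢ, eⱼ], eₖ)` of a frame. -/
def structureCoeff (g : FormField M) (e : Fin 3 → VField M) (x : M) (i j k : Fin 3) : ℝ :=
  g x (VectorField.mlieBracket (𝓡 3) (e i) (e j) x) (e k x)

theorem structureCoeff_antisymm (g : FormField M) (e : Fin 3 → VField M) (x : M)
    (i j k : Fin 3) : structureCoeff g e x i j k = -structureCoeff g e x j i k := by
  simp only [structureCoeff]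
  rw [VectorField.mlieBracket_swap_apply]
  simp

/-- The three derivative terms of the Koszul formula differentiate the constants `δᵢⱼ`, so only the
brackets survive. -/
theorem leviCivita_of_orthonormal {g : FormField M} {e : Fin 3 → VField M}
    (h : ∀ x i j, g x (e i x) (e j x) = if i = j then 1 else 0) (x : M) (k i j : Fin 3) :
    leviCivita g (e k) (e i) (e j) x = koszulCoeff (structureCoeff g e x) k i j := by
  simp only [leviCivita, koszulCoeff, structureCoeff, h, mvfderiv_const]
  simp

theorem dirac_eq (g : FormField M) (e : Fin 3 → VField M) (φ : M → Spinor) (x : M) :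
    dirac g e φ x = ∑ k, clifford k (mvfderiv (𝓡 3) φ x (e k x)) +
      (1 / 4 : ℝ) • ∑ k, ∑ i, ∑ j, leviCivita g (e k) (e i) (e j) x •
        clifford k (clifford i (clifford j (φ x))) := by
  simp only [dirac, spinDeriv, map_add, map_sum, clifford_real_smul, Finset.sum_add_distrib,
    Finset.smul_sum]

/-- The frame `r⁻¹ E` is orthonormal for the conformal metric `r² g`. -/
theorem conformal_orthonormal {g : FormField M} {E : Fin 3 → VField M}
    (hE : ∀ x i j, g x (E i x) (E j x) = if i = j then 1 else 0) {r : M → ℝ}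
    (hr : ∀ x, r x ≠ 0) (x : M) (i j : Fin 3) :
    (r x ^ 2 • g x) ((r x)⁻¹ • E i x) ((r x)⁻¹ • E j x) = if i = j then 1 else 0 := by
  have := hr x
  simp only [map_smul, _root_.smul_apply, hE, smul_eq_mul]
  split_ifs
  · field_simp
  · simp

/-- With `l = r⁻¹`, `[l Eₖ, l Eᵢ] = l² [Eₖ, Eᵢ] + l Eₖ(l) Eᵢ - l Eᵢ(l) Eₖ`; pairing with `l Eⱼ`
under `l⁻² g` divides by `l`. -/
theorem structureCoeff_conformal [IsManifold (𝓡 3) ∞ M] {g : FormField M} {E : Fin 3 → VField M} {x : M}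
    (hE : ∀ i j, g x (E i x) (E j x) = if i = j then 1 else 0)
    (hEd : ∀ k, MDifferentiableAt (𝓡 3) (𝓡 3).tangent
      (fun y => (⟨y, E k y⟩ : TangentBundle (𝓡 3) M)) x)
    {r : M → ℝ} (hr : r x ≠ 0) (hrd : MDifferentiableAt (𝓡 3) 𝓘(ℝ, ℝ) (fun y => (r y)⁻¹) x)
    (k i j : Fin 3) :
    structureCoeff (fun y => r y ^ 2 • g y) (fun k y => (r y)⁻¹ • E k y) x k i j
      = (r x)⁻¹ * structureCoeff g E x k i j
        + (if i = j then mvfderiv (𝓡 3) (fun y => (r y)⁻¹) x (E k x) else 0)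
        - (if k = j then mvfderiv (𝓡 3) (fun y => (r y)⁻¹) x (E i x) else 0) := by
  set l : M → ℝ := fun y => (r y)⁻¹ with hl
  have : IsManifold (𝓡 3) 1 M := IsManifold.of_le (n := ∞) (by simp)
  have : IsManifold (𝓡 3) 2 M := IsManifold.of_le (n := ∞) (by exact WithTop.coe_le_coe.2 le_top)
  have hbr : VectorField.mlieBracket (𝓡 3) (fun y => l y • E k y) (fun y => l y • E i y) x
      = -(mvfderiv (𝓡 3) l x (l x • E i x)) • E k x + l x • (mvfderiv (𝓡 3) l x (E k x) • E i x
        + l x • VectorField.mlieBracket (𝓡 3) (E k) (E i) x) := by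
    have h1 := VectorField.mlieBracket_smul_left (W := fun y => l y • E i y) hrd (hEd k)
    have h2 := VectorField.mlieBracket_smul_right (V := E k) hrd (hEd i)
    rw [← h2]
    exact h1
  have hlx : l x = (r x)⁻¹ := rfl
  simp only [structureCoeff]
  change (r x ^ 2 • g x) (VectorField.mlieBracket (𝓡 3) (fun y => l y • E k y)
    (fun y => l y • E i y) x) (l x • E j x) = _
  rw [hbr]
  simp [hE]
  simp only [hlx]
  split_ifs <;> field_simp <;> ring

/-- Conformal change of the connection coefficients of an orthonormal frame. -/
theorem leviCivita_conformal [IsManifold (𝓡 3) ∞ M] {g : FormField M} {E : Fin 3 → VField M}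
    (hE : ∀ x i j, g x (E i x) (E j x) = if i = j then 1 else 0) {x : M}
    (hEd : ∀ k, MDifferentiableAt (𝓡 3) (𝓡 3).tangent
      (fun y => (⟨y, E k y⟩ : TangentBundle (𝓡 3) M)) x)
    {r : M → ℝ} (hr : ∀ y, r y ≠ 0)
    (hrd : MDifferentiableAt (𝓡 3) 𝓘(ℝ, ℝ) (fun y => (r y)⁻¹) x) (k i j : Fin 3) :
    leviCivita (fun y => r y ^ 2 • g y) (fun y => (r y)⁻¹ • E k y) (fun y => (r y)⁻¹ • E i y)
        (fun y => (r y)⁻¹ • E j y) x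
      = (r x)⁻¹ * leviCivita g (E k) (E i) (E j) x
        + ((if i = k then mvfderiv (𝓡 3) (fun y => (r y)⁻¹) x (E j x) else 0)
          - (if j = k then mvfderiv (𝓡 3) (fun y => (r y)⁻¹) x (E i x) else 0)) := by
  rw [leviCivita_of_orthonormal hE]
  have h := leviCivita_of_orthonormal (g := fun y => r y ^ 2 • g y)
    (e := fun k y => (r y)⁻¹ • E k y) (conformal_orthonormal hE hr) x k i j
  refine h.trans ?_
  -- Of the six Kronecker terms, the two with `i = j` cancel and the other four agree in pairs,
  -- which absorbs the factor `1/2`.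
  simp only [koszulCoeff, structureCoeff_conformal (hE x) hEd (hr x) hrd, eq_comm (a := k),
    eq_comm (a := j) (b := i)]
  ring

/-- Conformal change of the Dirac operator in dimension three. -/
theorem dirac_conformal [IsManifold (𝓡 3) ∞ M] {g : FormField M} {E : Fin 3 → VField M}
    (hE : ∀ x i j, g x (E i x) (E j x) = if i = j then 1 else 0) {x : M}
    (hEd : ∀ k, MDifferentiableAt (𝓡 3) (𝓡 3).tangent
      (fun y => (⟨y, E k y⟩ : TangentBundle (𝓡 3) M)) x)
    {r : M → ℝ} (hr : ∀ y, r y ≠ 0)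
    (hrd : MDifferentiableAt (𝓡 3) 𝓘(ℝ, ℝ) (fun y => (r y)⁻¹) x) (φ : M → Spinor) :
    dirac (fun y => r y ^ 2 • g y) (fun k y => (r y)⁻¹ • E k y) φ x
      = (r x)⁻¹ • dirac g E φ x
        - ∑ k, mvfderiv (𝓡 3) (fun y => (r y)⁻¹) x (E k x) • clifford k (φ x) := by
  rw [dirac_eq, dirac_eq]
  simp only [leviCivita_conformal hE hEd hr hrd, add_smul, Finset.sum_add_distrib, smul_add,
    sum_clifford_conformal (fun k => mvfderiv (𝓡 3) (fun y => (r y)⁻¹) x (E k x)), map_smul,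
    clifford_real_smul, mul_smul, ← Finset.smul_sum]
  rw [smul_comm (1 / 4 : ℝ), sub_eq_add_neg, add_assoc]

end Frame

/-! ### Frames in charts -/

section Chart

variable {M : Type*} [TopologicalSpace M] [ChartedSpace Model M]

/-- The coordinate representation of a vector field in the preferred chart at `c`. -/
def chartField (X : VField M) (c : M) (y : Model) : Model :=
  VectorField.mpullback 𝓘(ℝ, Model) (𝓡 3) (extChartAt (𝓡 3) c).symm X y

/-- The determinant of the coordinate representation of a frame in the preferred chart at `c`. -/
def chartDet (E : Fin 3 → VField M) (c : M) (y : Model) : ℝ :=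
  (EuclideanSpace.basisFun (Fin 3) ℝ).toBasis.det fun k => chartField (E k) c y

variable [IsManifold (𝓡 3) ∞ M] {c : M} {y : Model}

theorem contMDiffAt_chart_symm (hy : y ∈ (extChartAt (𝓡 3) c).target) :
    ContMDiffAt 𝓘(ℝ, Model) (𝓡 3) ∞ (extChartAt (𝓡 3) c).symm y :=
  (contMDiffOn_extChartAt_symm c).contMDiffAt ((isOpen_extChartAt_target c).mem_nhds hy)

theorem isInvertible_mfderiv_chart_symm (hy : y ∈ (extChartAt (𝓡 3) c).target) :
    (mfderiv 𝓘(ℝ, Model) (𝓡 3) (extChartAt (𝓡 3) c).symm y).IsInvertible := by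
  have : IsManifold (𝓡 3) 1 M := IsManifold.of_le (n := ∞) (by simp)
  have h := isInvertible_mfderivWithin_extChartAt_symm (I := 𝓡 3) hy
  have hr : range (𝓡 3) = univ := by simp
  rwa [hr, mfderivWithin_univ] at h

theorem mfderiv_chartField (X : VField M) (hy : y ∈ (extChartAt (𝓡 3) c).target) :
    mfderiv 𝓘(ℝ, Model) (𝓡 3) (extChartAt (𝓡 3) c).symm y (chartField X c y)
      = X ((extChartAt (𝓡 3) c).symm y) := by
  obtain ⟨A, hA⟩ := isInvertible_mfderiv_chart_symm hy
  simp only [chartField, VectorField.mpullback, ← hA, ContinuousLinearMap.inverse_equiv]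
  exact A.apply_symm_apply _

theorem eq_chartField {X : VField M} (hy : y ∈ (extChartAt (𝓡 3) c).target) {v : Model}
    (hv : mfderiv 𝓘(ℝ, Model) (𝓡 3) (extChartAt (𝓡 3) c).symm y v
      = X ((extChartAt (𝓡 3) c).symm y)) : v = chartField X c y :=
  (isInvertible_mfderiv_chart_symm hy).injective (hv.trans (mfderiv_chartField X hy).symm)

theorem contDiffAt_chartField {X : VField M}
    (hX : ContMDiff (𝓡 3) ((𝓡 3).prod 𝓘(ℝ, Model)) ∞
      (fun x => (⟨x, X x⟩ : TangentBundle (𝓡 3) M)))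
    (hy : y ∈ (extChartAt (𝓡 3) c).target) : ContDiffAt ℝ ∞ (chartField X c) y :=
  contMDiffAt_vectorSpace_iff_contDiffAt.1
    (ContMDiffAt.mpullback_vectorField_preimage (n := ∞) (hX _) (contMDiffAt_chart_symm hy)
      (isInvertible_mfderiv_chart_symm hy) (by simp))

theorem mvfderiv_chart {F : Type*} [NormedAddCommGroup F] [NormedSpace ℝ F] {f : M → F}
    (X : VField M) (hy : y ∈ (extChartAt (𝓡 3) c).target)
    (hf : MDifferentiableAt (𝓡 3) 𝓘(ℝ, F) f ((extChartAt (𝓡 3) c).symm y)) :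
    mvfderiv (𝓡 3) f ((extChartAt (𝓡 3) c).symm y) (X ((extChartAt (𝓡 3) c).symm y))
      = fderiv ℝ (fun z => f ((extChartAt (𝓡 3) c).symm z)) y (chartField X c y) := by
  have h := (HasMFDerivAt.comp y hf.hasMFDerivAt
    ((contMDiffAt_chart_symm hy).mdifferentiableAt (by simp)).hasMFDerivAt).mfderiv
  rw [mfderiv_eq_fderiv] at h
  rw [← mfderiv_chartField X hy]
  exact (congrArg (fun A : Model →L[ℝ] F => A (chartField X c y)) h).symm

/-- Lie brackets are natural under pullback by the inverse chart; this lets structure functions be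
computed from derivatives of coordinate expressions. -/
theorem lieBracket_chartField {X Y : VField M}
    (hX : ContMDiff (𝓡 3) ((𝓡 3).prod 𝓘(ℝ, Model)) ∞
      (fun x => (⟨x, X x⟩ : TangentBundle (𝓡 3) M)))
    (hY : ContMDiff (𝓡 3) ((𝓡 3).prod 𝓘(ℝ, Model)) ∞
      (fun x => (⟨x, Y x⟩ : TangentBundle (𝓡 3) M)))
    (hy : y ∈ (extChartAt (𝓡 3) c).target) :
    VectorField.lieBracket ℝ (chartField X c) (chartField Y c) y
      = chartField (VectorField.mlieBracket (𝓡 3) X Y) c y := by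
  have : IsManifold (𝓡 3) (minSmoothness ℝ 3) M :=
    IsManifold.of_le (n := ∞) (by simp; exact WithTop.coe_le_coe.2 le_top)
  have h := VectorField.mpullback_mlieBracket (I := 𝓘(ℝ, Model)) (n := ∞)
    ((hX _).mdifferentiableAt (by simp)) ((hY _).mdifferentiableAt (by simp))
    (contMDiffAt_chart_symm hy) (by simp; exact WithTop.coe_le_coe.2 le_top)
  have h' : ∀ V W : (∀ x : Model, TangentSpace 𝓘(ℝ, Model) x),
      VectorField.mlieBracket 𝓘(ℝ, Model) V W = VectorField.lieBracket ℝ V W := fun V W => by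
    rw [← VectorField.mlieBracketWithin_univ, VectorField.mlieBracketWithin_eq_lieBracketWithin]
    exact VectorField.lieBracketWithin_univ
  exact (h.trans (congrFun (h' _ _) y)).symm

/-- In an orthonormal frame the Riemannian density is the inverse of the frame determinant. -/
theorem sq_chartDet_mul_det {g : FormField M} {E : Fin 3 → VField M}
    (hE : ∀ x i j, g x (E i x) (E j x) = if i = j then 1 else 0)
    (hy : y ∈ (extChartAt (𝓡 3) c).target) :
    chartDet E c y ^ 2 * Matrix.det (Matrix.of fun i j : Fin 3 =>
      g ((extChartAt (𝓡 3) c).symm y)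
        (mfderiv 𝓘(ℝ, Model) (𝓡 3) (extChartAt (𝓡 3) c).symm y
          (EuclideanSpace.single i (1 : ℝ) : Model))
        (mfderiv 𝓘(ℝ, Model) (𝓡 3) (extChartAt (𝓡 3) c).symm y
          (EuclideanSpace.single j (1 : ℝ) : Model))) = 1 := by
  set L := mfderiv 𝓘(ℝ, Model) (𝓡 3) (extChartAt (𝓡 3) c).symm y with hL
  set G : Matrix (Fin 3) (Fin 3) ℝ := Matrix.of fun i j : Fin 3 =>
      g ((extChartAt (𝓡 3) c).symm y) (L (EuclideanSpace.single i (1 : ℝ) : Model))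
        (L (EuclideanSpace.single j (1 : ℝ) : Model)) with hG
  set A : Matrix (Fin 3) (Fin 3) ℝ := Matrix.of fun m k => chartField (E k) c y m with hA
  have hdet : chartDet E c y = A.det := by
    rw [chartDet, Module.Basis.det_apply]
    rfl
  have hexp : ∀ k, E k ((extChartAt (𝓡 3) c).symm y)
      = ∑ m, A m k • L (EuclideanSpace.single m (1 : ℝ) : Model) := by
    intro k
    rw [← mfderiv_chartField (E k) hy, ← hL]
    have : chartField (E k) c y = ∑ m, A m k • (EuclideanSpace.single m (1 : ℝ) : Model) := by
      ext i
      fin_cases i <;> simp [hA, Fin.sum_univ_three]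
    conv_lhs => rw [this]
    exact (map_sum L _ _).trans (Finset.sum_congr rfl fun m _ => L.map_smul _ _)
  -- Orthonormality of the frame in matrix form, `A` being the frame and `G` the Gram matrix of the
  -- coordinate fields; determinants then give the claim.
  have hmul : A.transpose * G * A = 1 := by
    ext k l
    have h := hE ((extChartAt (𝓡 3) c).symm y) k l
    rw [hexp k, hexp l] at h
    rw [Matrix.one_apply, ← h]
    simp only [Matrix.mul_apply, Matrix.transpose_apply, hG, Matrix.of_apply,
      Fin.sum_univ_three, map_add, map_smul, _root_.add_apply, _root_.smul_apply, smul_eq_mul]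
    ring
  have := congrArg Matrix.det hmul
  rw [Matrix.det_mul, Matrix.det_mul, Matrix.det_transpose, Matrix.det_one] at this
  rw [hdet]
  linarith

theorem chartDet_ne_zero {g : FormField M} {E : Fin 3 → VField M}
    (hE : ∀ x i j, g x (E i x) (E j x) = if i = j then 1 else 0)
    (hy : y ∈ (extChartAt (𝓡 3) c).target) : chartDet E c y ≠ 0 := by
  intro h
  have := sq_chartDet_mul_det hE hy
  simp [h] at this

/-- This trades the square root of a Gram determinant for the determinant of a smooth frame, from
which regularity and transformation rules are read off. -/
theorem chartDensity_eq {g : FormField M} {E : Fin 3 → VField M}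
    (hE : ∀ x i j, g x (E i x) (E j x) = if i = j then 1 else 0)
    (hy : y ∈ (extChartAt (𝓡 3) c).target) : chartDensity g c y = |chartDet E c y|⁻¹ := by
  have h := sq_chartDet_mul_det hE hy
  rw [chartDensity]
  dsimp only
  rw [eq_inv_of_mul_eq_one_right h, Real.sqrt_inv, Real.sqrt_sq_eq_abs]

/-- The coordinate change from the chart at `c` to the chart at `c'`. -/
def transition (c c' : M) (y : Model) : Model :=
  extChartAt (𝓡 3) c' ((extChartAt (𝓡 3) c).symm y)

theorem differentiableAt_transition {c' : M} (hy : y ∈ (extChartAt (𝓡 3) c).target)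
    (hy' : (extChartAt (𝓡 3) c).symm y ∈ (extChartAt (𝓡 3) c').source) :
    DifferentiableAt ℝ (transition c c') y := by
  have h1 : ContMDiffAt (𝓡 3) 𝓘(ℝ, Model) ∞ (extChartAt (𝓡 3) c')
      ((extChartAt (𝓡 3) c).symm y) := contMDiffAt_extChartAt' (by simpa using hy')
  exact (ContMDiffAt.comp y h1 (contMDiffAt_chart_symm hy)).contDiffAt.differentiableAt (by simp)

/-- Both sides represent the same tangent vector of `M` in the chart at `c'`, and such a
representative is unique. -/
theorem fderiv_transition_chartField (X : VField M) {c' : M}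
    (hy : y ∈ (extChartAt (𝓡 3) c).target)
    (hy' : (extChartAt (𝓡 3) c).symm y ∈ (extChartAt (𝓡 3) c').source) :
    fderiv ℝ (transition c c') y (chartField X c y) = chartField X c' (transition c c' y) := by
  have hinv : (extChartAt (𝓡 3) c').symm (transition c c' y) = (extChartAt (𝓡 3) c).symm y :=
    (extChartAt (𝓡 3) c').left_inv hy'
  have hmem : transition c c' y ∈ (extChartAt (𝓡 3) c').target :=
    (extChartAt (𝓡 3) c').map_source hy'
  refine eq_chartField hmem ?_
  have hev : (fun z => (extChartAt (𝓡 3) c').symm (transition c c' z))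
      =ᶠ[nhds y] (extChartAt (𝓡 3) c).symm := by
    have hc : ContinuousAt (extChartAt (𝓡 3) c).symm y :=
      (contMDiffAt_chart_symm hy).continuousAt
    filter_upwards [hc.preimage_mem_nhds
      ((isOpen_extChartAt_source (I := 𝓡 3) c').mem_nhds hy')] with z hz
    exact (extChartAt (𝓡 3) c').left_inv hz
  have h1 := (HasMFDerivAt.comp y
    ((contMDiffAt_chart_symm hmem).mdifferentiableAt (by simp)).hasMFDerivAt
    (differentiableAt_transition hy hy').hasFDerivAt.hasMFDerivAt)
  have h2 := h1.mfderiv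
  have h3 : mfderiv 𝓘(ℝ, Model) (𝓡 3) (fun z => (extChartAt (𝓡 3) c').symm (transition c c' z)) y
    = mfderiv 𝓘(ℝ, Model) (𝓡 3) (extChartAt (𝓡 3) c).symm y := hev.mfderiv_eq
  have h4 : mfderiv 𝓘(ℝ, Model) (𝓡 3) (extChartAt (𝓡 3) c').symm (transition c c' y)
      (fderiv ℝ (transition c c') y (chartField X c y))
      = mfderiv 𝓘(ℝ, Model) (𝓡 3) (extChartAt (𝓡 3) c).symm y (chartField X c y) :=
    congrArg (fun A : Model →L[ℝ] Model => A (chartField X c y)) (h2.symm.trans h3)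
  have h5 : (X ((extChartAt (𝓡 3) c').symm (transition c c' y)) : Model)
      = X ((extChartAt (𝓡 3) c).symm y) := congrArg (fun p => (X p : Model)) hinv
  exact h4.trans ((mfderiv_chartField X hy).trans h5.symm)

theorem chartDet_transition (E : Fin 3 → VField M) {c' : M}
    (hy : y ∈ (extChartAt (𝓡 3) c).target)
    (hy' : (extChartAt (𝓡 3) c).symm y ∈ (extChartAt (𝓡 3) c').source) :
    chartDet E c' (transition c c' y)
      = (fderiv ℝ (transition c c') y).det * chartDet E c y := by
  rw [chartDet, chartDet, ContinuousLinearMap.det, ← Module.Basis.det_comp]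
  congr 1
  funext k
  exact (fderiv_transition_chartField (E k) hy hy').symm

/-- Frame determinants pick up the Jacobian under a change of chart, so their inverses pick up its
inverse. This is the compatibility needed for the change of variables. -/
theorem chartDensity_transition {g : FormField M} {E : Fin 3 → VField M}
    (hE : ∀ x i j, g x (E i x) (E j x) = if i = j then 1 else 0) {c' : M}
    (hy : y ∈ (extChartAt (𝓡 3) c).target)
    (hy' : (extChartAt (𝓡 3) c).symm y ∈ (extChartAt (𝓡 3) c').source) :
    |(fderiv ℝ (transition c c') y).det| * chartDensity g c' (transition c c' y)
      = chartDensity g c y := by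
  have h1 := chartDet_ne_zero hE hy
  have hmem : transition c c' y ∈ (extChartAt (𝓡 3) c').target :=
    (extChartAt (𝓡 3) c').map_source hy'
  have h2 := chartDet_ne_zero hE hmem
  rw [chartDensity_eq hE hy, chartDensity_eq hE hmem]
  rw [chartDet_transition E hy hy'] at h2 ⊢
  have h3 := left_ne_zero_of_mul h2
  rw [abs_mul]
  have := abs_ne_zero.2 h3
  have := abs_ne_zero.2 h1
  field_simp

end Chart

/-! ### The Riemannian volume -/


section Volume

variable {M : Type*} [TopologicalSpace M] [ChartedSpace Model M] [IsManifold (𝓡 3) ∞ M]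
  [MeasurableSpace M] [BorelSpace M] {g : FormField M} {E : Fin 3 → VField M}

theorem aemeasurable_chart_symm (c : M) :
    AEMeasurable (extChartAt (𝓡 3) c).symm (volume.restrict (extChartAt (𝓡 3) c).target) :=
  (continuousOn_extChartAt_symm c).aemeasurable (isOpen_extChartAt_target c).measurableSet

/-- The inverse chart is controlled only on its target, where it is continuous; measurability is
therefore obtained on the subtype and pushed forward. -/
theorem measurableSet_chart_preimage (c : M) {S : Set M} (hS : MeasurableSet S) :
    MeasurableSet ((extChartAt (𝓡 3) c).symm ⁻¹' S ∩ (extChartAt (𝓡 3) c).target) := by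
  have h : Measurable ((extChartAt (𝓡 3) c).target.domRestrict (extChartAt (𝓡 3) c).symm) :=
    (continuousOn_extChartAt_symm c).domRestrict.measurable
  have h2 := (isOpen_extChartAt_target (I := 𝓡 3) c).measurableSet.subtype_image (h hS)
  convert h2 using 1
  ext y
  exact ⟨fun hy => ⟨⟨y, hy.2⟩, hy.1, rfl⟩, by rintro ⟨⟨z, hz⟩, h, rfl⟩; exact ⟨h, hz⟩⟩

theorem chartVolume_apply (g : FormField M) (c : M) {S : Set M} (hS : MeasurableSet S) :
    chartVolume g c S = ∫⁻ y in (extChartAt (𝓡 3) c).symm ⁻¹' S ∩ (extChartAt (𝓡 3) c).target,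
      ENNReal.ofReal (chartDensity g c y) := by
  have h := (aemeasurable_chart_symm c).mono_ac
    (withDensity_absolutelyContinuous _ fun y => ENNReal.ofReal (chartDensity g c y))
  rw [chartVolume, Measure.map_apply_of_aemeasurable h hS, withDensity_apply',
    Measure.restrict_restrict' (isOpen_extChartAt_target c).measurableSet]

theorem chartVolume_inter_source (g : FormField M) (c : M) {S : Set M} (hS : MeasurableSet S) :
    chartVolume g c (S ∩ (extChartAt (𝓡 3) c).source) = chartVolume g c S := by
  rw [chartVolume_apply g c hS, chartVolume_apply g c
    (hS.inter (isOpen_extChartAt_source c).measurableSet)]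
  congr 2
  ext y
  simp only [mem_inter_iff, mem_preimage]
  constructor
  · rintro ⟨⟨h1, -⟩, h2⟩
    exact ⟨h1, h2⟩
  · rintro ⟨h1, h2⟩
    exact ⟨⟨h1, (extChartAt (𝓡 3) c).map_target h2⟩, h2⟩

/-- The chart volumes agree on the overlaps of the charts. -/
theorem chartVolume_eq_of_subset
    (hE : ∀ x i j, g x (E i x) (E j x) = if i = j then 1 else 0) {c c' : M} {S : Set M}
    (hS : MeasurableSet S) (hc : S ⊆ (extChartAt (𝓡 3) c).source)
    (hc' : S ⊆ (extChartAt (𝓡 3) c').source) : chartVolume g c S = chartVolume g c' S := by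
  set φ := extChartAt (𝓡 3) c with hφ
  set φ' := extChartAt (𝓡 3) c' with hφ'
  set U : Set Model := φ.symm ⁻¹' S ∩ φ.target with hU
  -- The coordinate change maps one coordinate image of `S` bijectively onto the other, which sets
  -- up the change of variables formula.
  have himage : Set.image (transition c c') U = φ'.symm ⁻¹' S ∩ φ'.target := by
    ext z
    constructor
    · rintro ⟨y, ⟨hy1, hy2⟩, rfl⟩
      have h1 : φ.symm y ∈ φ'.source := hc' hy1
      refine ⟨?_, φ'.map_source h1⟩
      change φ'.symm (φ' (φ.symm y)) ∈ S
      rw [φ'.left_inv h1]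
      exact hy1
    · rintro ⟨hz1, hz2⟩
      have h1 : φ'.symm z ∈ φ.source := hc hz1
      refine ⟨φ (φ'.symm z), ⟨?_, φ.map_source h1⟩, ?_⟩
      · change φ.symm (φ (φ'.symm z)) ∈ S
        rw [φ.left_inv h1]
        exact hz1
      · change φ' (φ.symm (φ (φ'.symm z))) = z
        rw [φ.left_inv h1, φ'.right_inv hz2]
  have hinj : InjOn (transition c c') U := by
    intro y hy z hz h
    exact φ.symm.injOn hy.2 hz.2 (φ'.injOn (hc' hy.1) (hc' hz.1) h)
  have hd : ∀ y ∈ U, HasFDerivWithinAt (transition c c') (fderiv ℝ (transition c c') y) U y :=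
    fun y hy => (differentiableAt_transition hy.2 (hc' hy.1)).hasFDerivAt.hasFDerivWithinAt
  rw [chartVolume_apply g c hS, chartVolume_apply g c' hS, ← himage,
    lintegral_image_eq_lintegral_abs_det_fderiv_mul volume (measurableSet_chart_preimage c hS) hd
      hinj]
  refine setLIntegral_congr_fun (measurableSet_chart_preimage c hS) fun y hy => ?_
  rw [← ENNReal.ofReal_mul (abs_nonneg _), chartDensity_transition hE hy.2 (hc' hy.1)]

/-- The prescribed first chart stays whole when the cover is made disjoint. -/
theorem exists_chart_sequence [CompactSpace M] (c : M) :
    ∃ u : ℕ → M, u 0 = c ∧ ⋃ n, (extChartAt (𝓡 3) (u n)).source = univ := by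
  obtain ⟨t, -, ht⟩ := isCompact_univ.elim_nhds_subcover
    (fun x : M => (extChartAt (𝓡 3) x).source) fun x _ => extChartAt_source_mem_nhds x
  have hne : (t : Set M).Nonempty := by
    have := ht (mem_univ c)
    simp only [mem_iUnion] at this
    obtain ⟨i, hi, -⟩ := this
    exact ⟨i, hi⟩
  obtain ⟨v, hv⟩ := t.countable_toSet.exists_eq_range hne
  refine ⟨fun n => Nat.casesOn n c v, rfl, eq_univ_of_forall fun x => ?_⟩
  have := ht (mem_univ x)
  simp only [mem_iUnion] at this
  obtain ⟨i, hi, hx⟩ := this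
  have hi' : i ∈ range v := hv ▸ hi
  obtain ⟨n, rfl⟩ := hi'
  exact mem_iUnion.2 ⟨n + 1, hx⟩

/-- A supremum of measures is hard to evaluate on a set, so it is bounded above by one explicit
measure. The chart volumes are glued along a countable disjoint partition beginning with the domain
at `c`; agreement on overlaps makes the result dominate every chart volume, while inside the domain
at `c` only the first piece contributes. -/
theorem volumeMeasure_apply_of_subset [CompactSpace M]
    (hE : ∀ x i j, g x (E i x) (E j x) = if i = j then 1 else 0) {c : M} {S : Set M}
    (hS : MeasurableSet S) (hc : S ⊆ (extChartAt (𝓡 3) c).source) :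
    volumeMeasure g S = chartVolume g c S := by
  obtain ⟨u, hu0, hu⟩ := exists_chart_sequence c
  set P : ℕ → Set M := disjointed fun n => (extChartAt (𝓡 3) (u n)).source with hP
  have hPm : ∀ n, MeasurableSet (P n) :=
    fun n => MeasurableSet.disjointed (fun m => (isOpen_extChartAt_source (u m)).measurableSet) n
  have hPs : ∀ n, P n ⊆ (extChartAt (𝓡 3) (u n)).source := fun n => disjointed_subset _ n
  have hPd : Pairwise (Function.onFun Disjoint P) := disjoint_disjointed _
  have hPu : ⋃ n, P n = univ := by rw [hP, iUnion_disjointed, hu]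
  -- The glued measure that dominates all chart volumes.
  set ν : Measure M := Measure.sum fun n => (chartVolume g (u n)).restrict (P n) with hν
  have hle : volumeMeasure g ≤ ν := by
    refine iSup_le fun c' => Measure.le_iff.2 fun A hA => ?_
    have hAm : MeasurableSet (A ∩ (extChartAt (𝓡 3) c').source) :=
      hA.inter (isOpen_extChartAt_source c').measurableSet
    rw [← chartVolume_inter_source g c' hA]
    have hsplit : A ∩ (extChartAt (𝓡 3) c').source
        = ⋃ n, (A ∩ (extChartAt (𝓡 3) c').source) ∩ P n := by
      rw [← inter_iUnion, hPu, inter_univ]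
    rw [hsplit, measure_iUnion (fun i j hij => (hPd hij).mono inter_subset_right inter_subset_right)
      (fun n => hAm.inter (hPm n)), hν, Measure.sum_apply _ hA]
    refine ENNReal.tsum_le_tsum fun n => ?_
    rw [Measure.restrict_apply hA, chartVolume_eq_of_subset hE (hAm.inter (hPm n))
      (fun x hx => hx.1.2) (fun x hx => hPs n hx.2)]
    exact measure_mono fun x hx => ⟨hx.1.1, hx.2⟩
  refine le_antisymm ?_ (Measure.le_iff.1 (le_iSup (fun c => chartVolume g c) c) S hS)
  refine (Measure.le_iff.1 hle S hS).trans ?_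
  have hP0 : P 0 = (extChartAt (𝓡 3) c).source := by rw [hP, disjointed_zero, hu0]
  rw [hν, Measure.sum_apply _ hS, tsum_eq_single 0]
  · rw [Measure.restrict_apply hS, hu0]
    exact measure_mono inter_subset_left
  · intro n hn
    rw [Measure.restrict_apply hS]
    have : S ∩ P n = ∅ := by
      have hd : Disjoint (P 0) (P n) := hPd hn.symm
      rw [hP0] at hd
      exact (hd.mono_left hc).inter_eq
    rw [this, measure_empty]

theorem volumeMeasure_restrict [CompactSpace M]
    (hE : ∀ x i j, g x (E i x) (E j x) = if i = j then 1 else 0) (c : M) :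
    (volumeMeasure g).restrict (extChartAt (𝓡 3) c).source = chartVolume g c := by
  ext A hA
  rw [Measure.restrict_apply hA, volumeMeasure_apply_of_subset hE
    (hA.inter (isOpen_extChartAt_source c).measurableSet) inter_subset_right,
    chartVolume_inter_source g c hA]

theorem continuousOn_chartDet
    (hEs : ∀ k, ContMDiff (𝓡 3) ((𝓡 3).prod 𝓘(ℝ, Model)) ∞
      (fun x => (⟨x, E k x⟩ : TangentBundle (𝓡 3) M))) (c : M) :
    ContinuousOn (chartDet E c) (extChartAt (𝓡 3) c).target := by
  have h : ∀ k, ContinuousOn (chartField (E k) c) (extChartAt (𝓡 3) c).target := fun k y hy =>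
    (contDiffAt_chartField (hEs k) hy).continuousAt.continuousWithinAt
  have h2 : ∀ k m, ContinuousOn (fun y => chartField (E k) c y m) (extChartAt (𝓡 3) c).target :=
    fun k m => (EuclideanSpace.proj m : Model →L[ℝ] ℝ).continuous.comp_continuousOn (h k)
  have h3 : chartDet E c
      = fun y => Matrix.det (Matrix.of fun m k : Fin 3 => chartField (E k) c y m) := by
    funext y
    rw [chartDet, Module.Basis.det_apply]
    rfl
  rw [h3]
  simp only [Matrix.det_fin_three, Matrix.of_apply]
  fun_prop

theorem continuousOn_chartDensity
    (hE : ∀ x i j, g x (E i x) (E j x) = if i = j then 1 else 0)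
    (hEs : ∀ k, ContMDiff (𝓡 3) ((𝓡 3).prod 𝓘(ℝ, Model)) ∞
      (fun x => (⟨x, E k x⟩ : TangentBundle (𝓡 3) M))) (c : M) :
    ContinuousOn (chartDensity g c) (extChartAt (𝓡 3) c).target :=
  ((continuousOn_chartDet hEs c).abs.inv₀ fun _ hy =>
    abs_ne_zero.2 (chartDet_ne_zero hE hy)).congr fun _ hy => chartDensity_eq hE hy

/-- A compact neighbourhood inside a chart has a compact coordinate image, on which the continuous
density is integrable; compactness of `M` passes from local finiteness to finiteness. -/
theorem isFiniteMeasure_volumeMeasure [CompactSpace M] [T2Space M]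
    (hE : ∀ x i j, g x (E i x) (E j x) = if i = j then 1 else 0)
    (hEs : ∀ k, ContMDiff (𝓡 3) ((𝓡 3).prod 𝓘(ℝ, Model)) ∞
      (fun x => (⟨x, E k x⟩ : TangentBundle (𝓡 3) M))) :
    IsFiniteMeasure (volumeMeasure g) := by
  have : IsLocallyFiniteMeasure (volumeMeasure g) := by
    refine ⟨fun x => ?_⟩
    obtain ⟨K, hKx, hKs, hK⟩ := local_compact_nhds (extChartAt_source_mem_nhds (I := 𝓡 3) x)
    refine ⟨K, hKx, ?_⟩
    rw [volumeMeasure_apply_of_subset hE hK.measurableSet hKs, chartVolume_apply g x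
      hK.measurableSet]
    have himg : (extChartAt (𝓡 3) x).symm ⁻¹' K ∩ (extChartAt (𝓡 3) x).target
        = extChartAt (𝓡 3) x '' K := by
      ext y
      constructor
      · rintro ⟨h1, h2⟩
        exact ⟨_, h1, (extChartAt (𝓡 3) x).right_inv h2⟩
      · rintro ⟨z, hz, rfl⟩
        refine ⟨?_, (extChartAt (𝓡 3) x).map_source (hKs hz)⟩
        rw [mem_preimage, (extChartAt (𝓡 3) x).left_inv (hKs hz)]
        exact hz
    have hcomp : IsCompact (extChartAt (𝓡 3) x '' K) :=
      hK.image_of_continuousOn ((continuousOn_extChartAt x).mono hKs)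
    rw [himg]
    have hint : IntegrableOn (chartDensity g x) (extChartAt (𝓡 3) x '' K) :=
      ContinuousOn.integrableOn_compact hcomp ((continuousOn_chartDensity hE hEs x).mono
        (himg ▸ inter_subset_right))
    exact hint.lintegral_lt_top
  infer_instance

theorem integral_chartVolume
    (hE : ∀ x i j, g x (E i x) (E j x) = if i = j then 1 else 0)
    (hEs : ∀ k, ContMDiff (𝓡 3) ((𝓡 3).prod 𝓘(ℝ, Model)) ∞
      (fun x => (⟨x, E k x⟩ : TangentBundle (𝓡 3) M))) (c : M) {f : M → ℝ} (hf : Measurable f) :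
    ∫ x, f x ∂(chartVolume g c) = ∫ y in (extChartAt (𝓡 3) c).target,
      chartDensity g c y * f ((extChartAt (𝓡 3) c).symm y) := by
  have h := (aemeasurable_chart_symm c).mono_ac
    (withDensity_absolutelyContinuous _ fun y => ENNReal.ofReal (chartDensity g c y))
  have hd : AEMeasurable (fun y => ENNReal.ofReal (chartDensity g c y))
      (volume.restrict (extChartAt (𝓡 3) c).target) :=
    ((continuousOn_chartDensity hE hEs c).aemeasurable
      (isOpen_extChartAt_target c).measurableSet).ennreal_ofReal
  rw [chartVolume, integral_map h hf.aestronglyMeasurable,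
    integral_withDensity_eq_integral_toReal_smul₀ hd (by simp)]
  refine integral_congr_ae (Filter.Eventually.of_forall fun y => ?_)
  have h0 : 0 ≤ chartDensity g c y := Real.sqrt_nonneg _
  simp only [smul_eq_mul, ENNReal.toReal_ofReal h0]

/-- The `3 × 3` Gram determinant scales by `(r²)³`, and the square root of this is `r³`. -/
theorem chartDensity_conformal (g : FormField M) {r : M → ℝ} (hr : ∀ x, 0 < r x) (c : M)
    (y : Model) : chartDensity (fun x => r x ^ 2 • g x) c y
      = r ((extChartAt (𝓡 3) c).symm y) ^ 3 * chartDensity g c y := by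
  have h := hr ((extChartAt (𝓡 3) c).symm y)
  simp only [chartDensity]
  rw [← Real.sqrt_sq (pow_nonneg h.le 3), ← Real.sqrt_mul (by positivity)]
  congr 1
  simp only [Matrix.det_fin_three, Matrix.of_apply, _root_.smul_apply, smul_eq_mul]
  ring

/-- Conformal change of the volume measure in dimension three. -/
theorem volumeMeasure_conformal [CompactSpace M]
    (hE : ∀ x i j, g x (E i x) (E j x) = if i = j then 1 else 0)
    (hEs : ∀ k, ContMDiff (𝓡 3) ((𝓡 3).prod 𝓘(ℝ, Model)) ∞
      (fun x => (⟨x, E k x⟩ : TangentBundle (𝓡 3) M)))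
    {r : M → ℝ} (hr : ∀ x, 0 < r x) (hrc : Continuous r) :
    volumeMeasure (fun x => r x ^ 2 • g x)
      = (volumeMeasure g).withDensity fun x => ENNReal.ofReal (r x ^ 3) := by
  rcases isEmpty_or_nonempty M with hM | ⟨⟨c₀⟩⟩
  · exact Subsingleton.elim _ _
  obtain ⟨u, -, hu⟩ := exists_chart_sequence c₀
  rw [← Measure.restrict_univ (μ := volumeMeasure _),
    ← Measure.restrict_univ (μ := (volumeMeasure g).withDensity _), ← hu,
    Measure.restrict_iUnion_congr]
  intro n
  have hrm : Measurable fun x => ENNReal.ofReal (r x ^ 3) :=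
    (hrc.pow 3).measurable.ennreal_ofReal
  -- On each chart domain both sides are explicit; the conformal metric is treated with its own
  -- orthonormal frame `r⁻¹ E`.
  rw [volumeMeasure_restrict (E := fun k x => (r x)⁻¹ • E k x)
    (conformal_orthonormal hE fun x => (hr x).ne'),
    restrict_withDensity (isOpen_extChartAt_source _).measurableSet, volumeMeasure_restrict hE]
  ext S hS
  have h := (aemeasurable_chart_symm (u n)).mono_ac
    (withDensity_absolutelyContinuous _ fun y => ENNReal.ofReal (chartDensity g (u n) y))
  have hd : AEMeasurable (fun y => ENNReal.ofReal (chartDensity g (u n) y))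
      (volume.restrict (extChartAt (𝓡 3) (u n)).target) :=
    ((continuousOn_chartDensity hE hEs (u n)).aemeasurable
      (isOpen_extChartAt_target (u n)).measurableSet).ennreal_ofReal
  have hF : AEMeasurable (fun y => S.indicator (fun x => ENNReal.ofReal (r x ^ 3))
      ((extChartAt (𝓡 3) (u n)).symm y)) (volume.restrict (extChartAt (𝓡 3) (u n)).target) :=
    (hrm.indicator hS).comp_aemeasurable (aemeasurable_chart_symm (u n))
  rw [chartVolume_apply _ _ hS, withDensity_apply _ hS, ← lintegral_indicator hS,
    chartVolume, lintegral_map' (hrm.indicator hS).aemeasurable h,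
    lintegral_withDensity_eq_lintegral_mul₀ hd hF,
    ← lintegral_indicator (measurableSet_chart_preimage (u n) hS),
    ← lintegral_indicator (isOpen_extChartAt_target (u n)).measurableSet]
  refine lintegral_congr fun y => ?_
  by_cases hy : y ∈ (extChartAt (𝓡 3) (u n)).target
  · rw [indicator_of_mem hy]
    by_cases hy' : (extChartAt (𝓡 3) (u n)).symm y ∈ S
    · have h0 : 0 ≤ chartDensity g (u n) y := Real.sqrt_nonneg _
      rw [indicator_of_mem (show y ∈ _ ∩ _ from ⟨hy', hy⟩), chartDensity_conformal g hr,
        Pi.mul_apply, indicator_of_mem hy', mul_comm, ENNReal.ofReal_mul h0]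
    · rw [indicator_of_notMem (fun h => hy' h.1), Pi.mul_apply, indicator_of_notMem hy', mul_zero]
  · rw [indicator_of_notMem hy, indicator_of_notMem (fun h => hy h.2)]

end Volume

/-! ### The divergence theorem -/

section Divergence

/-- The trace of the coordinates of `N aᵢ - bᵢ` in a basis `a` of `ℝ³`. -/
theorem trace_coords_mul_det (a b : Fin 3 → Fin 3 → ℝ) (N : Fin 3 → Fin 3 → ℝ)
    (q : Fin 3 → Fin 3 → ℝ)
    (h : ∀ i m, ∑ n, N m n * a i n - b i m = ∑ j, q i j * a j m) :
    (∑ i, q i i) * Matrix.det (Matrix.of fun m k => a k m)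
      = (∑ m, N m m) * Matrix.det (Matrix.of fun m k => a k m)
        - (Matrix.det (Matrix.of fun m k => ![b 0, a 1, a 2] k m)
          + Matrix.det (Matrix.of fun m k => ![a 0, b 1, a 2] k m)
          + Matrix.det (Matrix.of fun m k => ![a 0, a 1, b 2] k m)) := by
  -- With `b` eliminated, multilinearity remains: replacing each vector in turn by its image under
  -- `N` sums to `tr N · det`, and by its `q`-combination to `tr q · det`, since a repeated vector
  -- gives zero.
  have hb : ∀ i m, b i m = ∑ n, N m n * a i n - ∑ j, q i j * a j m := fun i m => by
    linarith [h i m]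
  simp only [Matrix.det_fin_three, Matrix.of_apply, Fin.sum_univ_three, Matrix.cons_val, hb]
  ring

/-- The derivative of the determinant of a triple of vectors. -/
theorem hasDerivAt_det_of {a : Fin 3 → ℝ → Model} {b : Fin 3 → Model} {t : ℝ}
    (h : ∀ k, HasDerivAt (a k) (b k) t) :
    HasDerivAt (fun s => Matrix.det (Matrix.of fun m k : Fin 3 => a k s m))
      (Matrix.det (Matrix.of fun m k => ![(b 0).ofLp, (a 1 t).ofLp, (a 2 t).ofLp] k m)
        + Matrix.det (Matrix.of fun m k => ![(a 0 t).ofLp, (b 1).ofLp, (a 2 t).ofLp] k m)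
        + Matrix.det (Matrix.of fun m k => ![(a 0 t).ofLp, (a 1 t).ofLp, (b 2).ofLp] k m)) t := by
  have hc : ∀ k m, HasDerivAt (fun s => a k s m) (b k m) t := fun k m =>
    (EuclideanSpace.proj m : Model →L[ℝ] ℝ).hasFDerivAt.comp_hasDerivAt t (h k)
  simp only [Matrix.det_fin_three, Matrix.of_apply, Matrix.cons_val]
  refine (((((((hc 0 0).mul (hc 1 1)).mul (hc 2 2)).sub (((hc 0 0).mul (hc 2 1)).mul (hc 1 2))).sub
    (((hc 1 0).mul (hc 0 1)).mul (hc 2 2))).add (((hc 1 0).mul (hc 2 1)).mul (hc 0 2))).add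
    (((hc 2 0).mul (hc 0 1)).mul (hc 1 2))).sub (((hc 2 0).mul (hc 1 1)).mul (hc 0 2))
    |>.congr_deriv ?_
  simp only [Pi.mul_apply]
  ring

theorem hasDerivAt_abs_inv {x : ℝ} (hx : x ≠ 0) :
    HasDerivAt (fun z : ℝ => |z|⁻¹) (-(|x|⁻¹ / x)) x := by
  rcases hx.lt_or_gt with h | h
  · have := (hasDerivAt_abs_neg h).inv (abs_ne_zero.2 hx)
    refine this.congr_deriv ?_
    rw [abs_of_neg h]
    field_simp
  · have := (hasDerivAt_abs_pos h).inv (abs_ne_zero.2 hx)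
    refine this.congr_deriv ?_
    rw [abs_of_pos h]
    field_simp

/-- The flat divergence theorem for compactly supported vector fields. -/
theorem integral_trace_fderiv_eq_zero {Q : Model → Model} (hQ : ContDiff ℝ 1 Q)
    (hc : HasCompactSupport Q) :
    ∫ y, ∑ m, fderiv ℝ Q y (EuclideanSpace.single m (1 : ℝ)) m = 0 := by
  have hcomp : ∀ (m : Fin 3) (y : Model), fderiv ℝ (fun y => Q y m) y
      (EuclideanSpace.single m (1 : ℝ)) = fderiv ℝ Q y (EuclideanSpace.single m (1 : ℝ)) m := by
    intro m y
    have := ((EuclideanSpace.proj m : Model →L[ℝ] ℝ).hasFDerivAt.comp y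
      (hQ.differentiable (by simp) y).hasFDerivAt).fderiv
    exact congrArg (fun A : Model →L[ℝ] ℝ => A (EuclideanSpace.single m (1 : ℝ))) this
  have hq : ∀ m : Fin 3, ContDiff ℝ 1 (fun y => Q y m) := fun m =>
    (EuclideanSpace.proj m : Model →L[ℝ] ℝ).contDiff.comp hQ
  have hqc : ∀ m : Fin 3, HasCompactSupport (fun y => Q y m) := fun m =>
    hc.comp_left (g := fun v : Model => v m) rfl
  have hint : ∀ m : Fin 3, Integrable (fun y => fderiv ℝ (fun y => Q y m) y
      (EuclideanSpace.single m (1 : ℝ))) := fun m =>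
    (((hq m).continuous_fderiv (by simp)).clm_apply continuous_const).integrable_of_hasCompactSupport
      ((hqc m).fderiv_apply ℝ _)
  simp only [← hcomp]
  rw [integral_finsetSum _ fun m _ => hint m]
  refine Finset.sum_eq_zero fun m _ => ?_
  -- Integration by parts against the constant function `1`.
  have := integral_mul_fderiv_eq_neg_fderiv_mul_of_integrable (μ := (volume : Measure Model))
    (f := fun _ => (1 : ℝ)) (g := fun y => Q y m) (v := EuclideanSpace.single m (1 : ℝ))
    (by simp) (by simpa using hint m)
    (by simpa using (hq m).continuous.integrable_of_hasCompactSupport (hqc m))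
    (fun _ _ => differentiableAt_const _) (fun y _ => (hq m).differentiable (by simp) y)
  simpa using this

variable {M : Type*} [TopologicalSpace M] [ChartedSpace Model M] [IsManifold (𝓡 3) ∞ M]
  {g : FormField M} {E : Fin 3 → VField M} {c : M} {y : Model}

theorem chartDet_eq_det (E : Fin 3 → VField M) (c : M) (y : Model) :
    chartDet E c y = Matrix.det (Matrix.of fun m k : Fin 3 => chartField (E k) c y m) := by
  rw [chartDet, Module.Basis.det_apply]
  rfl

theorem differentiableAt_chartDet
    (hEs : ∀ k, ContMDiff (𝓡 3) ((𝓡 3).prod 𝓘(ℝ, Model)) ∞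
      (fun x => (⟨x, E k x⟩ : TangentBundle (𝓡 3) M)))
    (hy : y ∈ (extChartAt (𝓡 3) c).target) : ContDiffAt ℝ ∞ (chartDet E c) y := by
  have h2 : ∀ k m, ContDiffAt ℝ ∞ (fun y => chartField (E k) c y m) y := fun k m =>
    (EuclideanSpace.proj m : Model →L[ℝ] ℝ).contDiff.contDiffAt.comp y
      (contDiffAt_chartField (hEs k) hy)
  have h3 : chartDet E c
      = fun y => Matrix.det (Matrix.of fun m k : Fin 3 => chartField (E k) c y m) :=
    funext fun y => chartDet_eq_det E c y
  rw [h3]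
  simp only [Matrix.det_fin_three, Matrix.of_apply]
  fun_prop

/-- A vector field is the combination of an orthonormal frame given by its scalar products. -/
theorem chartField_eq_sum (hE : ∀ x i j, g x (E i x) (E j x) = if i = j then 1 else 0)
    (X : VField M) (hy : y ∈ (extChartAt (𝓡 3) c).target) :
    chartField X c y = ∑ j, g ((extChartAt (𝓡 3) c).symm y) (X ((extChartAt (𝓡 3) c).symm y))
      (E j ((extChartAt (𝓡 3) c).symm y)) • chartField (E j) c y := by
  have hspan := ((Module.Basis.is_basis_iff_det (EuclideanSpace.basisFun (Fin 3) ℝ).toBasis).2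
    (isUnit_iff_ne_zero.2 (chartDet_ne_zero hE hy))).2
  have hmem : chartField X c y ∈ Submodule.span ℝ (range fun k => chartField (E k) c y) :=
    hspan ▸ Submodule.mem_top
  obtain ⟨b, hb⟩ := (Submodule.mem_span_range_iff_exists_fun ℝ).1 hmem
  have hX : X ((extChartAt (𝓡 3) c).symm y) = ∑ j, b j • E j ((extChartAt (𝓡 3) c).symm y) := by
    rw [← mfderiv_chartField X hy]
    simp only [← mfderiv_chartField (E _) hy]
    conv_lhs => rw [← hb]
    exact (map_sum _ _ _).trans (Finset.sum_congr rfl fun m _ => map_smul _ _ _)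
  rw [← hb]
  refine Finset.sum_congr rfl fun j _ => ?_
  congr 1
  rw [hX]
  simp only [Fin.sum_univ_three, map_add, map_smul, _root_.add_apply, _root_.smul_apply, hE,
    smul_eq_mul]
  fin_cases j <;> simp

/-- The divergence of a frame field, in coordinates. -/
theorem fderiv_density_add (hE : ∀ x i j, g x (E i x) (E j x) = if i = j then 1 else 0)
    (hEs : ∀ k, ContMDiff (𝓡 3) ((𝓡 3).prod 𝓘(ℝ, Model)) ∞
      (fun x => (⟨x, E k x⟩ : TangentBundle (𝓡 3) M)))
    (hy : y ∈ (extChartAt (𝓡 3) c).target) (k : Fin 3) :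
    fderiv ℝ (fun z => |chartDet E c z|⁻¹) y (chartField (E k) c y)
      + |chartDet E c y|⁻¹ * ∑ m, fderiv ℝ (chartField (E k) c) y
        (EuclideanSpace.single m (1 : ℝ)) m
      = |chartDet E c y|⁻¹ *
        ∑ i, structureCoeff g E ((extChartAt (𝓡 3) c).symm y) i k i := by
  have hd := chartDet_ne_zero hE hy
  have hda := fun k => (contDiffAt_chartField (hEs k) hy).differentiableAt (by simp)
  have hdd := (differentiableAt_chartDet hEs hy).differentiableAt (by simp)
  have h1 : fderiv ℝ (fun z => |chartDet E c z|⁻¹) y (chartField (E k) c y)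
      = -(|chartDet E c y|⁻¹ / chartDet E c y) *
        fderiv ℝ (chartDet E c) y (chartField (E k) c y) := by
    have := ((hasDerivAt_abs_inv hd).comp_hasFDerivAt y hdd.hasFDerivAt).fderiv
    exact congrArg (fun A : Model →L[ℝ] ℝ => A (chartField (E k) c y)) this
  -- The determinant is differentiated along the line through `y` in the direction of `Eₖ`; `h2` and
  -- `h3` compute the same derivative.
  have h2 := hasDerivAt_det_of (a := fun i s => chartField (E i) c (y + s • chartField (E k) c y))
    (b := fun i => fderiv ℝ (chartField (E i) c) y (chartField (E k) c y)) (t := 0)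
    (fun i => (hda i).hasFDerivAt.hasLineDerivAt _)
  have h3 : HasDerivAt (fun s : ℝ => chartDet E c (y + s • chartField (E k) c y))
      (fderiv ℝ (chartDet E c) y (chartField (E k) c y)) 0 :=
    hdd.hasFDerivAt.hasLineDerivAt _
  simp only [chartDet_eq_det] at h3
  have h4 := h3.unique h2
  -- Here `N` is the Jacobian of `Eₖ` and `bᵢ` the derivative of `Eᵢ` along `Eₖ`, so `N aᵢ - bᵢ` is
  -- the bracket `[Eᵢ, Eₖ]`, with the structure functions as its frame coordinates.
  have h5 := trace_coords_mul_det (fun i m => chartField (E i) c y m)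
    (fun i m => fderiv ℝ (chartField (E i) c) y (chartField (E k) c y) m)
    (fun m n => fderiv ℝ (chartField (E k) c) y (EuclideanSpace.single n (1 : ℝ)) m)
    (fun i j => structureCoeff g E ((extChartAt (𝓡 3) c).symm y) i k j) ?_
  · rw [← chartDet_eq_det] at h5
    simp only [zero_smul, add_zero] at h4
    have h6 : fderiv ℝ (chartDet E c) y (chartField (E k) c y)
      = (∑ m, fderiv ℝ (chartField (E k) c) y (EuclideanSpace.single m (1 : ℝ)) m)
        * chartDet E c y
        - (∑ i, structureCoeff g E ((extChartAt (𝓡 3) c).symm y) i k i) * chartDet E c y := by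
      rw [h5, sub_sub_cancel]
      exact h4
    rw [h1, h6]
    field_simp
    ring
  · intro i m
    have h := lieBracket_chartField (hEs i) (hEs k) hy
    rw [chartField_eq_sum hE _ hy, VectorField.lieBracket] at h
    have hs : chartField (E i) c y
        = ∑ n, chartField (E i) c y n • (EuclideanSpace.single n (1 : ℝ) : Model) := by
      ext l
      fin_cases l <;> simp [Fin.sum_univ_three]
    have hs' : fderiv ℝ (chartField (E k) c) y (chartField (E i) c y)
        = ∑ n, chartField (E i) c y n •
          fderiv ℝ (chartField (E k) c) y (EuclideanSpace.single n (1 : ℝ)) := by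
      conv_lhs => rw [hs]
      simp only [map_sum, map_smul]
    rw [hs'] at h
    have hm := congrArg (fun v : Model => v m) h
    simp only [PiLp.sub_apply, PiLp.add_apply, PiLp.smul_apply, Fin.sum_univ_three,
      smul_eq_mul] at hm
    simp only [Fin.sum_univ_three, structureCoeff]
    rw [← hm]
    ring

end Divergence

/-! ### The divergence theorem on a closed manifold -/

section DivergenceTheorem

variable {M : Type*} [TopologicalSpace M] [ChartedSpace Model M] [IsManifold (𝓡 3) ∞ M]
  {g : FormField M} {E : Fin 3 → VField M}

theorem contMDiff_mvfderiv_apply {F : Type*} [NormedAddCommGroup F] [NormedSpace ℝ F]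
    {f : M → F} (hf : ContMDiff (𝓡 3) 𝓘(ℝ, F) ∞ f) {X : VField M}
    (hX : ContMDiff (𝓡 3) ((𝓡 3).prod 𝓘(ℝ, Model)) ∞
      (fun x => (⟨x, X x⟩ : TangentBundle (𝓡 3) M))) :
    ContMDiff (𝓡 3) 𝓘(ℝ, F) ∞ (fun x => mvfderiv (𝓡 3) f x (X x)) := fun x =>
  contMDiffAt_mvfderiv_apply (f := fun _ : M => f) (b := id)
    (ContMDiffAt.comp (x, x) (g := f) (f := Prod.snd) (hf x) contMDiffAt_snd) (hX x)

/-- The density `Eₖ f + (div Eₖ) f`. -/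
def divergenceDensity (g : FormField M) (E : Fin 3 → VField M) (k : Fin 3) (f : M → ℝ) (x : M) :
    ℝ :=
  mvfderiv (𝓡 3) f x (E k x) + f x * ∑ i, structureCoeff g E x i k i

theorem continuous_divergenceDensity
    (hEs : ∀ k, ContMDiff (𝓡 3) ((𝓡 3).prod 𝓘(ℝ, Model)) ∞
      (fun x => (⟨x, E k x⟩ : TangentBundle (𝓡 3) M)))
    (hc : ∀ i j k, Continuous fun x => structureCoeff g E x i j k) (k : Fin 3) {f : M → ℝ}
    (hf : ContMDiff (𝓡 3) 𝓘(ℝ, ℝ) ∞ f) : Continuous (divergenceDensity g E k f) :=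
  (contMDiff_mvfderiv_apply hf (hEs k)).continuous.add
    (hf.continuous.mul (continuous_finsetSum _ fun i _ => hc i k i))

theorem divergenceDensity_eq_zero (k : Fin 3) {f : M → ℝ} {x : M} (hx : x ∉ tsupport f) :
    divergenceDensity g E k f x = 0 := by
  have h : f =ᶠ[nhds x] fun _ => 0 := notMem_tsupport_iff_eventuallyEq.1 hx
  rw [divergenceDensity, mvfderiv_congr h, mvfderiv_const, h.eq_of_nhds]
  simp

variable [MeasurableSpace M] [BorelSpace M] [CompactSpace M]

/-- In coordinates the density times the integrand is the flat divergence of `f · √det g · Eₖ`, a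
compactly supported field. -/
theorem integral_divergenceDensity_of_tsupport_subset [T2Space M]
    (hE : ∀ x i j, g x (E i x) (E j x) = if i = j then 1 else 0)
    (hEs : ∀ k, ContMDiff (𝓡 3) ((𝓡 3).prod 𝓘(ℝ, Model)) ∞
      (fun x => (⟨x, E k x⟩ : TangentBundle (𝓡 3) M)))
    (hc : ∀ i j k, Continuous fun x => structureCoeff g E x i j k) (k : Fin 3) {f : M → ℝ}
    (hf : ContMDiff (𝓡 3) 𝓘(ℝ, ℝ) ∞ f) {c : M}
    (hs : tsupport f ⊆ (extChartAt (𝓡 3) c).source) :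
    ∫ x, divergenceDensity g E k f x ∂(volumeMeasure g) = 0 := by
  set φ := extChartAt (𝓡 3) c with hφ
  set K : Set Model := φ '' tsupport f with hK
  have hKc : IsCompact K :=
    (isClosed_tsupport f).isCompact.image_of_continuousOn ((continuousOn_extChartAt c).mono hs)
  have hKt : K ⊆ φ.target := by
    rintro _ ⟨x, hx, rfl⟩
    exact φ.map_source (hs hx)
  have hout : ∀ y ∈ φ.target, y ∉ K → f (φ.symm y) = 0 := by
    intro y hy hyK
    by_contra h
    exact hyK ⟨φ.symm y, subset_tsupport f h, φ.right_inv hy⟩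
  classical
  -- Outside the target the inverse chart has no meaning, so the field is set to zero there. It
  -- already vanishes off the compact `K`, so regularity is not lost.
  set Q : Model → Model := fun y => if y ∈ φ.target then
    (f (φ.symm y) * |chartDet E c y|⁻¹) • chartField (E k) c y else 0 with hQ
  have hQt : ∀ y ∈ φ.target, Q =ᶠ[nhds y]
      fun y => (f (φ.symm y) * |chartDet E c y|⁻¹) • chartField (E k) c y := by
    intro y hy
    filter_upwards [(isOpen_extChartAt_target c).mem_nhds hy] with z hz
    exact if_pos hz
  have hQK : ∀ y, y ∉ K → Q y = 0 := by
    intro y hy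
    by_cases h : y ∈ φ.target
    · simp [hQ, hout y h hy]
    · simp only [hQ]
      exact if_neg h
  have hfs : ∀ y ∈ φ.target, ContDiffAt ℝ ∞ (fun y => f (φ.symm y)) y := fun y hy =>
    (ContMDiffAt.comp y (hf _) (contMDiffAt_chart_symm hy)).contDiffAt
  have hws : ∀ y ∈ φ.target, ContDiffAt ℝ ∞ (fun y => |chartDet E c y|⁻¹) y := fun y hy =>
    ((contDiffAt_abs (chartDet_ne_zero hE hy)).comp y (differentiableAt_chartDet hEs hy)).inv
      (abs_ne_zero.2 (chartDet_ne_zero hE hy))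
  have hQs : ContDiff ℝ 1 Q := by
    rw [contDiff_iff_contDiffAt]
    intro y
    by_cases h : y ∈ φ.target
    · refine ContDiffAt.congr_of_eventuallyEq ?_ (hQt y h)
      exact (((hfs y h).mul (hws y h)).smul (contDiffAt_chartField (hEs k) h)).of_le (by simp)
    · have : Q =ᶠ[nhds y] fun _ => 0 := by
        filter_upwards [hKc.isClosed.isOpen_compl.mem_nhds (fun hy => h (hKt hy))] with z hz
        exact hQK z hz
      exact contDiffAt_const.congr_of_eventuallyEq this
  have hQc : HasCompactSupport Q := HasCompactSupport.intro hKc fun y hy => hQK y hy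
  have hdiv : ∀ y ∈ φ.target, ∑ m, fderiv ℝ Q y (EuclideanSpace.single m (1 : ℝ)) m
      = chartDensity g c y * divergenceDensity g E k f (φ.symm y) := by
    intro y hy
    have hf1 := (hfs y hy).differentiableAt (by simp)
    have hw1 := (hws y hy).differentiableAt (by simp)
    have ha1 := (contDiffAt_chartField (hEs k) hy).differentiableAt (by simp)
    have hd := ((hf1.hasFDerivAt.fun_mul hw1.hasFDerivAt).fun_smul ha1.hasFDerivAt).fderiv
    have hsum : ∀ L : Model →L[ℝ] ℝ, L (chartField (E k) c y)
        = ∑ m, L (EuclideanSpace.single m (1 : ℝ)) * chartField (E k) c y m := by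
      intro L
      have hs : chartField (E k) c y
          = ∑ n, chartField (E k) c y n • (EuclideanSpace.single n (1 : ℝ) : Model) := by
        ext l
        fin_cases l <;> simp [Fin.sum_univ_three]
      conv_lhs => rw [hs]
      simp only [map_sum, map_smul, smul_eq_mul, mul_comm]
    have key := fderiv_density_add hE hEs hy k
    rw [(hQt y hy).fderiv_eq]
    rw [divergenceDensity, mvfderiv_chart (E k) hy (hf.mdifferentiableAt (by simp)),
      chartDensity_eq hE hy]
    rw [hsum] at key
    rw [hsum, hd]
    simp only [_root_.add_apply, _root_.smul_apply, ContinuousLinearMap.smulRight_apply,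
      PiLp.add_apply, PiLp.smul_apply, Fin.sum_univ_three, smul_eq_mul] at key ⊢
    linear_combination f (φ.symm y) * key
  rw [← setIntegral_eq_integral_of_forall_compl_eq_zero (s := φ.source)
    (fun x hx => divergenceDensity_eq_zero k fun h => hx (hs h)),
    volumeMeasure_restrict hE, integral_chartVolume hE hEs c
      (continuous_divergenceDensity hEs hc k hf).measurable,
    ← setIntegral_congr_fun (isOpen_extChartAt_target c).measurableSet hdiv,
    setIntegral_eq_integral_of_forall_compl_eq_zero, integral_trace_fderiv_eq_zero hQs hQc]
  intro y hy
  have : Q =ᶠ[nhds y] fun _ => 0 := by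
    filter_upwards [hKc.isClosed.isOpen_compl.mem_nhds (fun h => hy (hKt h))] with z hz
    exact hQK z hz
  rw [this.fderiv_eq]
  simp

/-- The divergence theorem for a global orthonormal frame on a closed manifold. -/
theorem integral_divergenceDensity [T2Space M]
    (hE : ∀ x i j, g x (E i x) (E j x) = if i = j then 1 else 0)
    (hEs : ∀ k, ContMDiff (𝓡 3) ((𝓡 3).prod 𝓘(ℝ, Model)) ∞
      (fun x => (⟨x, E k x⟩ : TangentBundle (𝓡 3) M)))
    (hc : ∀ i j k, Continuous fun x => structureCoeff g E x i j k) (k : Fin 3) {f : M → ℝ}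
    (hf : ContMDiff (𝓡 3) 𝓘(ℝ, ℝ) ∞ f) :
    ∫ x, divergenceDensity g E k f x ∂(volumeMeasure g) = 0 := by
  obtain ⟨t, -, ht⟩ := isCompact_univ.elim_nhds_subcover
    (fun x : M => (extChartAt (𝓡 3) x).source) fun x _ => extChartAt_source_mem_nhds x
  obtain ⟨χ, hχ⟩ := SmoothPartitionOfUnity.exists_isSubordinate (𝓡 3) isClosed_univ
    (fun i : t => (extChartAt (𝓡 3) (i : M)).source)
    (fun i => isOpen_extChartAt_source (i : M)) (by
      intro x hx
      have := ht hx
      simp only [mem_iUnion] at this ⊢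
      obtain ⟨i, hi, hx⟩ := this
      exact ⟨⟨i, hi⟩, hx⟩)
  have hfin := isFiniteMeasure_volumeMeasure hE hEs
  have hprod : ∀ i, ContMDiff (𝓡 3) 𝓘(ℝ, ℝ) ∞ (fun x => χ i x * f x) := fun i =>
    (χ i).contMDiff.mul hf
  have hsum : ∀ x, ∑ i, χ i x * f x = f x := by
    intro x
    have := χ.sum_eq_one (mem_univ x)
    rw [finsum_eq_sum_of_fintype] at this
    rw [← Finset.sum_mul, this, one_mul]
  -- The density is additive in `f`, and the partition of unity is indexed by a finite set.
  have hD : ∀ x, divergenceDensity g E k f x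
      = ∑ i, divergenceDensity g E k (fun x => χ i x * f x) x := by
    intro x
    simp only [divergenceDensity]
    rw [Finset.sum_add_distrib, ← Finset.sum_mul, hsum]
    congr 1
    have h1 : mvfderiv (𝓡 3) f x (E k x) = mvfderiv (𝓡 3) (fun x => ∑ i, χ i x * f x) x (E k x) := by
      congr 2
      exact (funext hsum).symm
    have h2 : ContMDiff (𝓡 3) 𝓘(ℝ, ℝ) ∞ (fun x => ∑ i, χ i x * f x) :=
      contMDiff_finsetSum fun i _ => hprod i
    have h3 : ∀ i, DifferentiableAt ℝ (fun y => χ i ((extChartAt (𝓡 3) x).symm y) *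
        f ((extChartAt (𝓡 3) x).symm y)) (extChartAt (𝓡 3) x x) := fun i =>
      (ContMDiffAt.comp _ (hprod i _)
        (contMDiffAt_chart_symm (mem_extChartAt_target x))).contDiffAt.differentiableAt (by simp)
    rw [h1, mvfderiv_eq_fderiv (h2.mdifferentiableAt (by simp)), fderiv_fun_sum fun i _ => h3 i]
    simp only [mvfderiv_eq_fderiv ((hprod _).mdifferentiableAt (by simp))]
    exact _root_.sum_apply _ _ _
  have hcont : ∀ i, Continuous (divergenceDensity g E k (fun x => χ i x * f x)) := fun i =>
    continuous_divergenceDensity hEs hc k (hprod i)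
  simp only [hD]
  rw [integral_finsetSum _ fun i _ =>
    (hcont i).integrable_of_hasCompactSupport (HasCompactSupport.of_compactSpace _)]
  refine Finset.sum_eq_zero fun i _ => ?_
  refine integral_divergenceDensity_of_tsupport_subset hE hEs hc k (hprod i) (c := (i : M)) ?_
  exact (tsupport_mul_subset_left).trans (hχ i)

end DivergenceTheorem

/-! ### Symmetry of the Dirac operator -/

section Symmetry

variable {M : Type*} [TopologicalSpace M] [ChartedSpace Model M] [IsManifold (𝓡 3) ∞ M]
  {g : FormField M} {E : Fin 3 → VField M}

theorem contMDiff_structureCoeff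
    (g₀ : Bundle.ContMDiffRiemannianMetric (𝓡 3) ∞ Model (fun x : M => TangentSpace (𝓡 3) x))
    (hEs : ∀ k, ContMDiff (𝓡 3) ((𝓡 3).prod 𝓘(ℝ, Model)) ∞
      (fun x => (⟨x, E k x⟩ : TangentBundle (𝓡 3) M))) (i j k : Fin 3) :
    ContMDiff (𝓡 3) 𝓘(ℝ, ℝ) ∞ (fun x => structureCoeff g₀.inner E x i j k) := by
  have hbr : ContMDiff (𝓡 3) (𝓡 3).tangent ∞ (fun x =>
      (⟨x, VectorField.mlieBracket (𝓡 3) (E i) (E j) x⟩ : TangentBundle (𝓡 3) M)) := by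
    have : IsManifold (𝓡 3) ((⊤ : ℕ∞) + 1) M := by simpa using ‹IsManifold (𝓡 3) ∞ M›
    have : IsManifold (𝓡 3) (minSmoothness ℝ 2) M :=
      IsManifold.of_le (n := ∞) (by simp; exact WithTop.coe_le_coe.2 le_top)
    have : IsManifold (𝓡 3) (minSmoothness ℝ 3) M :=
      IsManifold.of_le (n := ∞) (by simp; exact WithTop.coe_le_coe.2 le_top)
    exact fun x => ContMDiffAt.mlieBracket_vectorField (n := ⊤) (m := ⊤) (hEs i x) (hEs j x)
      (by simp)
  have h : ContMDiff (𝓡 3) ((𝓡 3).prod 𝓘(ℝ, ℝ)) ∞ (fun x => Bundle.TotalSpace.mk' ℝ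
      (E := Bundle.Trivial M ℝ) x
      (g₀.inner x (VectorField.mlieBracket (𝓡 3) (E i) (E j) x) (E k x))) :=
    ContMDiff.clm_bundle_apply₂ (F₁ := Model) (F₂ := Model) g₀.contMDiff hbr (hEs k)
  intro x
  have := h x
  simp only [Bundle.contMDiffAt_totalSpace] at this
  exact this.2

theorem mvfderiv_re_inner {u v : M → Spinor} (hu : ContMDiff (𝓡 3) 𝓘(ℝ, Spinor) ∞ u)
    (hv : ContMDiff (𝓡 3) 𝓘(ℝ, Spinor) ∞ v) (x : M) (w : TangentSpace (𝓡 3) x) :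
    mvfderiv (𝓡 3) (fun y => (inner ℂ (u y) (v y)).re) x w
      = (inner ℂ (mvfderiv (𝓡 3) u x w) (v x)).re
        + (inner ℂ (u x) (mvfderiv (𝓡 3) v x w)).re := by
  have h1 : HasFDerivAt (fun p : Spinor × Spinor => (inner ℂ p.1 p.2).re)
      (Complex.reCLM.comp ((fderivInnerCLM ℂ (u x, v x)).comp
        ((ContinuousLinearMap.fst ℝ Spinor Spinor).prod (ContinuousLinearMap.snd ℝ Spinor Spinor))))
      (u x, v x) :=
    Complex.reCLM.hasFDerivAt.comp (u x, v x)
      (HasFDerivAt.inner (x := (u x, v x)) ℂ hasFDerivAt_fst hasFDerivAt_snd)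
  have hux := hu.mdifferentiableAt (x := x) (by simp)
  have hvx := hv.mdifferentiableAt (x := x) (by simp)
  have h2 := mvfderiv_comp_hasFDerivAt (f := fun y => (u y, v y)) h1
    (hux.prodMk_space hvx) w
  have h3 : mvfderiv (𝓡 3) (fun y => (u y, v y)) x w
      = (mvfderiv (𝓡 3) u x w, mvfderiv (𝓡 3) v x w) := by
    exact Prod.ext
      (mvfderiv_comp_hasFDerivAt (f := fun y => (u y, v y)) hasFDerivAt_fst
        (hux.prodMk_space hvx) w).symm
      (mvfderiv_comp_hasFDerivAt (f := fun y => (u y, v y)) hasFDerivAt_snd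
        (hux.prodMk_space hvx) w).symm
  rw [h2, h3]
  simp [fderivInnerCLM_apply, add_comm]

theorem contMDiff_re_inner {u v : M → Spinor} (hu : ContMDiff (𝓡 3) 𝓘(ℝ, Spinor) ∞ u)
    (hv : ContMDiff (𝓡 3) 𝓘(ℝ, Spinor) ∞ v) :
    ContMDiff (𝓡 3) 𝓘(ℝ, ℝ) ∞ (fun y => (inner ℂ (u y) (v y)).re) := by
  have h : ContDiff ℝ ∞ (fun p : Spinor × Spinor => (inner ℂ p.1 p.2).re) :=
    Complex.reCLM.contDiff.comp (contDiff_fst.inner ℂ contDiff_snd)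
  exact h.contMDiff.comp (hu.prodMk_space hv)

/-- Clifford multiplication as a real linear map. -/
def cliffordReal (k : Fin 3) : Spinor →L[ℝ] Spinor := (clifford k).restrictScalars ℝ

theorem contMDiff_clifford (k : Fin 3) {u : M → Spinor}
    (hu : ContMDiff (𝓡 3) 𝓘(ℝ, Spinor) ∞ u) :
    ContMDiff (𝓡 3) 𝓘(ℝ, Spinor) ∞ (fun y => clifford k (u y)) :=
  (cliffordReal k).contDiff.contMDiff.comp hu

theorem mvfderiv_clifford (k : Fin 3) {u : M → Spinor}
    (hu : ContMDiff (𝓡 3) 𝓘(ℝ, Spinor) ∞ u) (x : M) (w : TangentSpace (𝓡 3) x) :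
    mvfderiv (𝓡 3) (fun y => clifford k (u y)) x w = clifford k (mvfderiv (𝓡 3) u x w) :=
  mvfderiv_comp_hasFDerivAt (cliffordReal k).hasFDerivAt (hu.mdifferentiableAt (by simp)) w

theorem dirac_eq_koszul (hE : ∀ x i j, g x (E i x) (E j x) = if i = j then 1 else 0)
    (φ : M → Spinor) (x : M) :
    dirac g E φ x = ∑ k, clifford k (mvfderiv (𝓡 3) φ x (E k x)) +
      (1 / 4 : ℝ) • ∑ k, ∑ i, ∑ j, koszulCoeff (structureCoeff g E x) k i j •
        clifford k (clifford i (clifford j (φ x))) := by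
  simp only [dirac_eq, leviCivita_of_orthonormal hE]

/-- The Dirac operator is formally symmetric up to a divergence. -/
theorem re_inner_dirac_sub (hE : ∀ x i j, g x (E i x) (E j x) = if i = j then 1 else 0)
    {u v : M → Spinor} (hu : ContMDiff (𝓡 3) 𝓘(ℝ, Spinor) ∞ u)
    (hv : ContMDiff (𝓡 3) 𝓘(ℝ, Spinor) ∞ v) (x : M) :
    (inner ℂ (dirac g E u x) (v x)).re - (inner ℂ (u x) (dirac g E v x)).re
      = ∑ k, divergenceDensity g E k (fun y => (inner ℂ (clifford k (u y)) (v y)).re) x := by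
  have hz := re_inner_connection_sub (structureCoeff g E x) (structureCoeff_antisymm g E x)
    (u x) (v x)
  simp only [divergenceDensity, mvfderiv_re_inner (contMDiff_clifford _ hu) hv,
    mvfderiv_clifford _ hu, Finset.sum_add_distrib]
  rw [dirac_eq_koszul hE, dirac_eq_koszul hE, inner_add_left, inner_add_right, Complex.add_re,
    Complex.add_re]
  simp only [sum_inner, inner_sum, Complex.re_sum] at hz ⊢
  -- Skew-symmetry of `γₖ` turns the Leibniz term `⟨γₖ u, Eₖ v⟩` into `-⟨u, γₖ Eₖ v⟩`, the first
  -- order part of the second pairing.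
  simp only [re_inner_clifford_left _ (u x) (mvfderiv (𝓡 3) v x _), Finset.sum_neg_distrib]
  simp only [mul_comm (∑ i, structureCoeff g E x i _ i)] at hz
  rw [← hz]
  ring

variable [MeasurableSpace M] [BorelSpace M] [CompactSpace M] [T2Space M]

theorem integral_re_inner_dirac (hE : ∀ x i j, g x (E i x) (E j x) = if i = j then 1 else 0)
    (hEs : ∀ k, ContMDiff (𝓡 3) ((𝓡 3).prod 𝓘(ℝ, Model)) ∞
      (fun x => (⟨x, E k x⟩ : TangentBundle (𝓡 3) M)))
    (hc : ∀ i j k, Continuous fun x => structureCoeff g E x i j k)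
    {u v : M → Spinor} (hu : ContMDiff (𝓡 3) 𝓘(ℝ, Spinor) ∞ u)
    (hv : ContMDiff (𝓡 3) 𝓘(ℝ, Spinor) ∞ v)
    (hDu : Continuous (dirac g E u)) (hDv : Continuous (dirac g E v)) :
    ∫ x, (inner ℂ (dirac g E u x) (v x)).re ∂(volumeMeasure g)
      = ∫ x, (inner ℂ (u x) (dirac g E v x)).re ∂(volumeMeasure g) := by
  have hfin := isFiniteMeasure_volumeMeasure hE hEs
  have hint : ∀ {f : M → ℝ}, Continuous f → Integrable f (volumeMeasure g) := fun hf =>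
    hf.integrable_of_hasCompactSupport (HasCompactSupport.of_compactSpace _)
  have h1 : Continuous fun x => (inner ℂ (dirac g E u x) (v x)).re :=
    Complex.continuous_re.comp (hDu.inner hv.continuous)
  have h2 : Continuous fun x => (inner ℂ (u x) (dirac g E v x)).re :=
    Complex.continuous_re.comp (hu.continuous.inner hDv)
  rw [← sub_eq_zero, ← integral_sub (hint h1) (hint h2)]
  simp only [re_inner_dirac_sub hE hu hv]
  have hs := fun k => contMDiff_re_inner (contMDiff_clifford k hu) hv
  rw [integral_finsetSum _ fun k _ => hint (continuous_divergenceDensity hEs hc k (hs k))]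
  exact Finset.sum_eq_zero fun k _ => integral_divergenceDensity hE hEs hc k (hs k)

end Symmetry

/-! ### Families of spinor fields -/

section Families

variable {M : Type*} [TopologicalSpace M] [ChartedSpace Model M]
  {F G : Type*} [NormedAddCommGroup F] [NormedSpace ℝ F]
  [NormedAddCommGroup G] [NormedSpace ℝ G] {T t : ℝ}

namespace SmoothFamily

variable {f f' : ℝ → M → F} {a : ℝ → M → ℝ}

theorem congr (hf : SmoothFamily T f) (h : ∀ s ∈ Ioo 0 T, ∀ x, f' s x = f s x) :
    SmoothFamily T f' :=
  ContMDiffOn.congr hf fun p hp => h p.1 hp.1 p.2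

theorem clm (L : F →L[ℝ] G) (hf : SmoothFamily T f) : SmoothFamily T (fun s x => L (f s x)) :=
  hf.comp fun _ _ _ => L.contDiff.contDiffAt

theorem add (hf : SmoothFamily T f) (hf' : SmoothFamily T f') :
    SmoothFamily T (fun s x => f s x + f' s x) :=
  (hf.prodMk hf').comp fun _ _ _ => (contDiff_fst.add contDiff_snd).contDiffAt

theorem sub (hf : SmoothFamily T f) (hf' : SmoothFamily T f') :
    SmoothFamily T (fun s x => f s x - f' s x) :=
  (hf.prodMk hf').comp fun _ _ _ => (contDiff_fst.sub contDiff_snd).contDiffAt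

theorem smul (ha : SmoothFamily T a) (hf : SmoothFamily T f) :
    SmoothFamily T (fun s x => a s x • f s x) :=
  (ha.prodMk hf).comp fun _ _ _ => (contDiff_fst.smul contDiff_snd).contDiffAt

theorem sum {ι : Type*} {S : Finset ι} {f : ι → ℝ → M → F} (hf : ∀ i, SmoothFamily T (f i)) :
    SmoothFamily T (fun s x => ∑ i ∈ S, f i s x) :=
  of_contMDiffAt fun _ ht x => contMDiffAt_finsetSum fun i _ => (hf i).contMDiffAt ht x

/-- Differentiation under the integral sign on a closed manifold. -/
theorem hasDerivAt_integral [CompactSpace M] [IsManifold (𝓡 3) ∞ M] [MeasurableSpace M]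
    [BorelSpace M] (ha : SmoothFamily T a) (ht : t ∈ Ioo 0 T) (ν : Measure M)
    [IsFiniteMeasure ν] :
    HasDerivAt (fun s => ∫ x, a s x ∂ν) (∫ x, _root_.deriv (fun s => a s x) t ∂ν) t := by
  -- A compact time window around `t`; on its product with `M` the time derivative has a uniform
  -- bound, which serves as the dominating constant.
  have hsub : Icc (t / 2) ((t + T) / 2) ⊆ Ioo 0 T := fun s hs =>
    ⟨by linarith [ht.1, hs.1], by linarith [ht.2, hs.2]⟩
  have hmem : Icc (t / 2) ((t + T) / 2) ∈ nhds t :=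
    Icc_mem_nhds (by linarith [ht.1]) (by linarith [ht.2])
  obtain ⟨C, hC⟩ := (isCompact_Icc.prod isCompact_univ).exists_bound_of_continuousOn
    (ha.deriv.continuousOn.mono (prod_mono_left hsub))
  have hint : ∀ {f : M → ℝ}, Continuous f → Integrable f ν := fun hf =>
    hf.integrable_of_hasCompactSupport (HasCompactSupport.of_compactSpace _)
  refine (hasDerivAt_integral_of_dominated_loc_of_deriv_le (bound := fun _ => C)
    (F' := fun s x => _root_.deriv (fun s => a s x) s) hmem ?_
    (hint (ha.continuous_slice ht)) (ha.deriv.continuous_slice ht).measurable.aestronglyMeasurable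
    ?_ (integrable_const C) ?_).2
  · filter_upwards [hmem] with s hs
    exact (ha.continuous_slice (hsub hs)).measurable.aestronglyMeasurable
  · exact Filter.Eventually.of_forall fun x s hs => hC (s, x) ⟨hs, mem_univ _⟩
  · exact Filter.Eventually.of_forall fun x s hs => ha.hasDerivAt (hsub hs) x

end SmoothFamily

variable [IsManifold (𝓡 3) ∞ M] {g : FormField M} {E : Fin 3 → VField M}

theorem SmoothFamily.dirac {φ : ℝ → M → Spinor} (hφ : SmoothFamily T φ)
    (hE : ∀ x i j, g x (E i x) (E j x) = if i = j then 1 else 0)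
    (hEs : ∀ k, ContMDiff (𝓡 3) ((𝓡 3).prod 𝓘(ℝ, Model)) ∞
      (fun x => (⟨x, E k x⟩ : TangentBundle (𝓡 3) M)))
    (hc : ∀ i j k, ContMDiff (𝓡 3) 𝓘(ℝ, ℝ) ∞ (fun x => structureCoeff g E x i j k)) :
    SmoothFamily T (fun s => dirac g E (φ s)) := by
  have hk : ∀ k i j, SmoothFamily T
      (fun (_ : ℝ) x => koszulCoeff (structureCoeff g E x) k i j) := fun k i j =>
    const_time (contMDiff_const.mul (((hc k i j).sub (hc i j k)).add (hc j k i)))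
  have h := (SmoothFamily.sum (S := Finset.univ)
      fun k => (hφ.mvfderiv (hEs k)).clm (cliffordReal k)).add
    (SmoothFamily.clm ((1 / 4 : ℝ) • ContinuousLinearMap.id ℝ Spinor)
      (SmoothFamily.sum (S := Finset.univ) fun k => SmoothFamily.sum (S := Finset.univ) fun i =>
        SmoothFamily.sum (S := Finset.univ) fun j => (hk k i j).smul
          (((hφ.clm (cliffordReal j)).clm (cliffordReal i)).clm (cliffordReal k))))
  exact h.congr fun s _ x => dirac_eq_koszul hE (φ s) x

theorem hasDerivAt_dirac {φ : ℝ → M → Spinor} (hφ : SmoothFamily T φ) (ht : t ∈ Ioo 0 T)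
    (x : M) : HasDerivAt (fun s => dirac g E (φ s) x)
      (dirac g E (fun y => deriv (fun s => φ s y) t) x) t := by
  simp only [dirac_eq]
  refine HasDerivAt.add (HasDerivAt.fun_sum fun k _ => ?_) (HasDerivAt.fun_const_smul _
    (HasDerivAt.fun_sum fun k _ => HasDerivAt.fun_sum fun i _ => HasDerivAt.fun_sum fun j _ =>
      HasDerivAt.fun_const_smul _ ?_))
  · exact (cliffordReal k).hasFDerivAt.comp_hasDerivAt t (hφ.hasDerivAt_mvfderiv ht x (E k x))
  · exact ((cliffordReal k).comp ((cliffordReal i).comp (cliffordReal j))).hasFDerivAt.comp_hasDerivAt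
      t (hφ.hasDerivAt ht x)

theorem dirac_smul {f : M → ℝ} (hf : ContMDiff (𝓡 3) 𝓘(ℝ, ℝ) ∞ f) {u : M → Spinor}
    (hu : ContMDiff (𝓡 3) 𝓘(ℝ, Spinor) ∞ u) (x : M) :
    dirac g E (fun y => f y • u y) x
      = f x • dirac g E u x + ∑ k, mvfderiv (𝓡 3) f x (E k x) • clifford k (u x) := by
  have h : ∀ v : TangentSpace (𝓡 3) x, mvfderiv (𝓡 3) (fun y => f y • u y) x v
      = f x • mvfderiv (𝓡 3) u x v + mvfderiv (𝓡 3) f x v • u x := fun v => by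
    rw [mvfderiv_fun_smul (hf.mdifferentiableAt (by simp)) (hu.mdifferentiableAt (by simp))]
    rfl
  simp only [dirac_eq, h, map_add, clifford_real_smul, Finset.sum_add_distrib, smul_add,
    ← Finset.smul_sum, smul_comm _ (f x)]
  abel

/-- The Dirac operator of the conformal metric `l⁻² g` in the frame `l E`. -/
def conformalDirac (g : FormField M) (E : Fin 3 → VField M) (l : M → ℝ) (φ : M → Spinor) (x : M) :
    Spinor :=
  l x • dirac g E φ x - ∑ k, mvfderiv (𝓡 3) l x (E k x) • clifford k (φ x)

theorem SmoothFamily.conformalDirac {l : ℝ → M → ℝ} (hl : SmoothFamily T l)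
    {φ : ℝ → M → Spinor} (hφ : SmoothFamily T φ)
    (hE : ∀ x i j, g x (E i x) (E j x) = if i = j then 1 else 0)
    (hEs : ∀ k, ContMDiff (𝓡 3) ((𝓡 3).prod 𝓘(ℝ, Model)) ∞
      (fun x => (⟨x, E k x⟩ : TangentBundle (𝓡 3) M)))
    (hc : ∀ i j k, ContMDiff (𝓡 3) 𝓘(ℝ, ℝ) ∞ (fun x => structureCoeff g E x i j k)) :
    SmoothFamily T (fun s => conformalDirac g E (l s) (φ s)) :=
  (hl.smul (hφ.dirac hE hEs hc)).sub (SmoothFamily.sum (S := Finset.univ) fun k =>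
    (hl.mvfderiv (hEs k)).smul (hφ.clm (cliffordReal k)))

/-- The operator is bilinear in `(l, φ)` and its remaining coefficients do not depend on time, so
this is the product rule combined with commuting derivatives. -/
theorem hasDerivAt_conformalDirac {l : ℝ → M → ℝ} (hl : SmoothFamily T l)
    {φ : ℝ → M → Spinor} (hφ : SmoothFamily T φ) (ht : t ∈ Ioo 0 T) (x : M) :
    HasDerivAt (fun s => conformalDirac g E (l s) (φ s) x)
      (conformalDirac g E (fun y => deriv (fun s => l s y) t) (φ t) x
        + conformalDirac g E (l t) (fun y => deriv (fun s => φ s y) t) x) t := by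
  have h1 := (hl.hasDerivAt ht x).fun_smul (hasDerivAt_dirac (g := g) (E := E) hφ ht x)
  have h2 := HasDerivAt.fun_sum (u := Finset.univ) fun (k : Fin 3) _ =>
    (hl.hasDerivAt_mvfderiv ht x (E k x)).fun_smul
      ((cliffordReal k).hasFDerivAt.comp_hasDerivAt t (hφ.hasDerivAt ht x))
  refine (h1.fun_sub h2).congr_deriv ?_
  simp only [conformalDirac, Finset.sum_add_distrib]
  change _ + _ - (∑ k, _ • clifford k _ + ∑ k, _ • clifford k _) = _
  abel

theorem mvfderiv_inv {l : M → ℝ} {x : M} (hl : MDifferentiableAt (𝓡 3) 𝓘(ℝ, ℝ) l x)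
    (h0 : l x ≠ 0) (v : TangentSpace (𝓡 3) x) :
    mvfderiv (𝓡 3) (fun y => (l y)⁻¹) x v = -(l x ^ 2)⁻¹ * mvfderiv (𝓡 3) l x v := by
  rw [mvfderiv_comp_hasFDerivAt (hasDerivAt_inv h0).hasFDerivAt hl v]
  simp [mul_comm]

/-- The conformal covariance of the Dirac operator. -/
theorem conformalDirac_eq {l : M → ℝ} (hl : ContMDiff (𝓡 3) 𝓘(ℝ, ℝ) ∞ l) (h0 : ∀ x, l x ≠ 0)
    {u : M → Spinor} (hu : ContMDiff (𝓡 3) 𝓘(ℝ, Spinor) ∞ u) (x : M) :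
    conformalDirac g E l u x = l x ^ 2 • dirac g E (fun y => (l y)⁻¹ • u y) x := by
  have h := h0 x
  rw [dirac_smul (hl.inv₀ h0) hu]
  simp only [mvfderiv_inv (hl.mdifferentiableAt (by simp)) h, mul_smul, ← Finset.smul_sum,
    conformalDirac]
  rw [smul_add, smul_smul, smul_smul]
  have e1 : l x ^ 2 * (l x)⁻¹ = l x := by field_simp
  have e2 : l x ^ 2 * -(l x ^ 2)⁻¹ = -1 := by field_simp
  rw [e1, e2, neg_one_smul, sub_eq_add_neg]

theorem hasDerivAt_norm_sq {f : ℝ → Spinor} {f' : Spinor} (hf : HasDerivAt f f' t) :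
    HasDerivAt (fun s => ‖f s‖ ^ 2) (2 * (inner ℂ f' (f t)).re) t := by
  have h := Complex.reCLM.hasFDerivAt.comp_hasDerivAt t (hf.inner ℂ hf)
  have h2 : (fun s => ‖f s‖ ^ 2) = Complex.reCLM ∘ fun s => inner ℂ (f s) (f s) := by
    funext s
    simp [inner_self_eq_norm_sq_to_K, ← Complex.ofReal_pow]
  rw [h2]
  refine h.congr_deriv ?_
  have h3 : (inner ℂ (f t) f').re = (inner ℂ f' (f t)).re := by
    rw [← inner_conj_symm, Complex.conj_re]
  simp [h3]
  ring

variable [MeasurableSpace M] [BorelSpace M] [CompactSpace M] [T2Space M]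

/-- Symmetry of the conformal Dirac operator. -/
theorem integral_re_inner_conformalDirac
    (hE : ∀ x i j, g x (E i x) (E j x) = if i = j then 1 else 0)
    (hEs : ∀ k, ContMDiff (𝓡 3) ((𝓡 3).prod 𝓘(ℝ, Model)) ∞
      (fun x => (⟨x, E k x⟩ : TangentBundle (𝓡 3) M)))
    (hc : ∀ i j k, ContMDiff (𝓡 3) 𝓘(ℝ, ℝ) ∞ (fun x => structureCoeff g E x i j k))
    {l : M → ℝ} (hl : ContMDiff (𝓡 3) 𝓘(ℝ, ℝ) ∞ l) (h0 : ∀ x, l x ≠ 0)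
    {u v : M → Spinor} (hu : ContMDiff (𝓡 3) 𝓘(ℝ, Spinor) ∞ u)
    (hv : ContMDiff (𝓡 3) 𝓘(ℝ, Spinor) ∞ v) :
    ∫ x, (l x)⁻¹ ^ 3 * (inner ℂ (conformalDirac g E l u x) (v x)).re ∂(volumeMeasure g)
      = ∫ x, (l x)⁻¹ ^ 3 * (inner ℂ (u x) (conformalDirac g E l v x)).re ∂(volumeMeasure g) := by
  have hcont : ∀ {w : M → Spinor}, ContMDiff (𝓡 3) 𝓘(ℝ, Spinor) ∞ w →
      -- A fixed field is viewed as a constant family; the interval `(0, 2)` and the time `1` are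
      -- arbitrary.
      Continuous (dirac g E w) := fun {w} hw =>
    (((SmoothFamily.const_time (T := 2) hw).dirac hE hEs hc).continuous_slice
      (t := 1) (by norm_num))
  have hu' : ContMDiff (𝓡 3) 𝓘(ℝ, Spinor) ∞ (fun x => (l x)⁻¹ • u x) :=
    (hl.inv₀ h0).smul hu
  have hv' : ContMDiff (𝓡 3) 𝓘(ℝ, Spinor) ∞ (fun x => (l x)⁻¹ • v x) :=
    (hl.inv₀ h0).smul hv
  -- By covariance the weight satisfies `l⁻³ · l² = l⁻¹`, and this factor is absorbed by the other
  -- argument: the pairing is that of `D₀(l⁻¹ u)` with `l⁻¹ v`.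
  have h := integral_re_inner_dirac hE hEs (fun i j k => (hc i j k).continuous) hu' hv'
    (hcont hu') (hcont hv')
  have e : ∀ x (a b : Spinor), (inner ℂ (l x ^ 2 • a) b).re = l x ^ 2 * (inner ℂ a b).re ∧
      (inner ℂ a (l x ^ 2 • b)).re = l x ^ 2 * (inner ℂ a b).re ∧
      (inner ℂ ((l x)⁻¹ • a) b).re = (l x)⁻¹ * (inner ℂ a b).re ∧
      (inner ℂ a ((l x)⁻¹ • b)).re = (l x)⁻¹ * (inner ℂ a b).re := by
    intro x a b
    simp only [← Complex.coe_smul, inner_smul_left, inner_smul_right, Complex.conj_ofReal,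
      Complex.re_ofReal_mul, and_self]
  convert h using 2 <;> funext x
  · rw [conformalDirac_eq hl h0 hu, (e x _ _).1, (e x _ _).2.2.2]
    have := h0 x
    field_simp
  · rw [conformalDirac_eq hl h0 hv, (e x _ _).2.1, (e x _ _).2.2.1]
    have := h0 x
    field_simp

end Families

/-! ### The conformal flow -/

section Flow

variable {M : Type*} [TopologicalSpace M] [ChartedSpace Model M] {T t : ℝ}
  {ψ : ℝ → M → Spinor}

theorem smoothFamily_norm (hψ : SmoothFamily T ψ) (hne : ∀ t ∈ Ioo 0 T, ∀ x, ψ t x ≠ 0) :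
    SmoothFamily T (fun s x => ‖ψ s x‖) :=
  hψ.comp fun t ht x => contDiffAt_norm ℂ (hne t ht x)

theorem smoothFamily_norm_inv (hψ : SmoothFamily T ψ) (hne : ∀ t ∈ Ioo 0 T, ∀ x, ψ t x ≠ 0) :
    SmoothFamily T (fun s x => ‖ψ s x‖⁻¹) :=
  (smoothFamily_norm hψ hne).comp fun t ht x => contDiffAt_inv ℝ (norm_ne_zero_iff.2 (hne t ht x))

theorem deriv_norm_inv (hψ : SmoothFamily T ψ) (hne : ∀ t ∈ Ioo 0 T, ∀ x, ψ t x ≠ 0)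
    (ht : t ∈ Ioo 0 T) (x : M) :
    deriv (fun s => ‖ψ s x‖⁻¹) t = -deriv (fun s => ‖ψ s x‖) t / ‖ψ t x‖ ^ 2 :=
  (((smoothFamily_norm hψ hne).hasDerivAt ht x).inv (norm_ne_zero_iff.2 (hne t ht x))).deriv

variable {g : FormField M} {E : Fin 3 → VField M}

theorem hasDerivAt_inducedMetric (hψ : SmoothFamily T ψ)
    (hne : ∀ t ∈ Ioo 0 T, ∀ x, ψ t x ≠ 0) (ht : t ∈ Ioo 0 T) (x : M)
    (v w : TangentSpace (𝓡 3) x) :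
    HasDerivAt (fun s => inducedMetric g (ψ s) x v w)
      (2 * ‖ψ t x‖ * deriv (fun s => ‖ψ s x‖) t * g x v w) t := by
  have h := (((smoothFamily_norm hψ hne).hasDerivAt ht x).fun_pow 2).mul_const (g x v w)
  exact h.congr_deriv (by simp)

theorem metricVelocity_eq (hψ : SmoothFamily T ψ)
    (hne : ∀ t ∈ Ioo 0 T, ∀ x, ψ t x ≠ 0) (ht : t ∈ Ioo 0 T) (x : M)
    (v w : TangentSpace (𝓡 3) x) :
    metricVelocity g ψ t x v w = 2 * ‖ψ t x‖ * deriv (fun s => ‖ψ s x‖) t * g x v w :=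
  (hasDerivAt_inducedMetric hψ hne ht x v w).deriv

/-- The velocity is `2 ρ ρ' g₀`, and each of the three frame vectors has `g₀`-square `ρ⁻²`. -/
theorem frameTrace_metricVelocity
    (hE : ∀ x i j, g x (E i x) (E j x) = if i = j then 1 else 0) (hψ : SmoothFamily T ψ)
    (hne : ∀ t ∈ Ioo 0 T, ∀ x, ψ t x ≠ 0) (ht : t ∈ Ioo 0 T) (x : M) :
    frameTrace (inducedFrame E (ψ t)) (metricVelocity g ψ t) x
      = 6 * deriv (fun s => ‖ψ s x‖) t / ‖ψ t x‖ := by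
  have h0 := norm_ne_zero_iff.2 (hne t ht x)
  simp only [frameTrace, metricVelocity_eq hψ hne ht, inducedFrame, map_smul, _root_.smul_apply,
    hE, smul_eq_mul, if_true, Fin.sum_univ_three]
  field_simp
  ring

variable [IsManifold (𝓡 3) ∞ M]

theorem inducedDirac_eq (hE : ∀ x i j, g x (E i x) (E j x) = if i = j then 1 else 0)
    (hEs : ∀ k, ContMDiff (𝓡 3) ((𝓡 3).prod 𝓘(ℝ, Model)) ∞
      (fun x => (⟨x, E k x⟩ : TangentBundle (𝓡 3) M)))
    (hψ : SmoothFamily T ψ) (hne : ∀ t ∈ Ioo 0 T, ∀ x, ψ t x ≠ 0) (ht : t ∈ Ioo 0 T)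
    (φ : M → Spinor) :
    inducedDirac g E (ψ t) φ = conformalDirac g E (fun x => ‖ψ t x‖⁻¹) φ := by
  funext x
  exact dirac_conformal (r := fun x => ‖ψ t x‖) hE
    (fun k => (hEs k).mdifferentiableAt (by simp))
    (fun y => norm_ne_zero_iff.2 (hne t ht y))
    ((smoothFamily_norm_inv hψ hne).mdifferentiableAt ht x) φ

/-- As `D_l` is linear in `l`, its variation must be `D_{l'}`. With `tr h = -6 l'/l` and the frame
`l E`, the terms containing the derivative of `l` cancel between the gradient and `(tr h) D φ`. -/
theorem diracVariation_eq (hE : ∀ x i j, g x (E i x) (E j x) = if i = j then 1 else 0)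
    (hEs : ∀ k, ContMDiff (𝓡 3) ((𝓡 3).prod 𝓘(ℝ, Model)) ∞
      (fun x => (⟨x, E k x⟩ : TangentBundle (𝓡 3) M)))
    (hψ : SmoothFamily T ψ) (hne : ∀ t ∈ Ioo 0 T, ∀ x, ψ t x ≠ 0) (ht : t ∈ Ioo 0 T)
    (φ : M → Spinor) :
    diracVariation (inducedMetric g (ψ t)) (inducedFrame E (ψ t)) (metricVelocity g ψ t) φ
      = conformalDirac g E (fun x => deriv (fun s => ‖ψ s x‖⁻¹) t) φ := by
  funext x
  set l : M → ℝ := fun x => ‖ψ t x‖⁻¹ with hl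
  set l' : M → ℝ := fun x => deriv (fun s => ‖ψ s x‖⁻¹) t with hl'
  have h0 : ∀ x, l x ≠ 0 := fun x => inv_ne_zero (norm_ne_zero_iff.2 (hne t ht x))
  have hld : MDifferentiableAt (𝓡 3) 𝓘(ℝ, ℝ) l x :=
    (smoothFamily_norm_inv hψ hne).mdifferentiableAt ht x
  have hld' : MDifferentiableAt (𝓡 3) 𝓘(ℝ, ℝ) l' x :=
    (smoothFamily_norm_inv hψ hne).deriv.mdifferentiableAt ht x
  have htr : frameTrace (inducedFrame E (ψ t)) (metricVelocity g ψ t)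
      = fun x => -6 * (l' x * (l x)⁻¹) := by
    -- Uses `l' = -ρ'/ρ²`.
    funext y
    have := norm_ne_zero_iff.2 (hne t ht y)
    rw [frameTrace_metricVelocity hE hψ hne ht]
    simp only [hl', hl, deriv_norm_inv hψ hne ht]
    field_simp
  have hinv : MDifferentiableAt (𝓡 3) 𝓘(ℝ, ℝ) (fun y => (l y)⁻¹) x := by
    simpa [hl] using (smoothFamily_norm hψ hne).mdifferentiableAt ht x
  have hdtr : ∀ v : TangentSpace (𝓡 3) x,
      mvfderiv (𝓡 3) (fun x => -6 * (l' x * (l x)⁻¹)) x v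
        = -6 * ((l x)⁻¹ * mvfderiv (𝓡 3) l' x v
          - l' x * ((l x ^ 2)⁻¹ * mvfderiv (𝓡 3) l x v)) := by
    intro v
    have h1 := mvfderiv_comp_hasFDerivAt (f := fun y => l' y * (l y)⁻¹) (x := x)
      (((hasDerivAt_id _).const_mul (-6 : ℝ)).hasFDerivAt) (hld'.mul hinv) v
    refine h1.trans ?_
    rw [mvfderiv_fun_mul hld' hinv, _root_.add_apply, _root_.smul_apply, _root_.smul_apply,
      mvfderiv_inv hld (h0 x)]
    simp only [ContinuousLinearMap.toSpanSingleton_apply, smul_eq_mul]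
    ring
  have hD : dirac (inducedMetric g (ψ t)) (inducedFrame E (ψ t)) φ x
      = conformalDirac g E l φ x := congrFun (inducedDirac_eq hE hEs hψ hne ht φ) x
  have hfr : ∀ k, mvfderiv (𝓡 3) (fun x => -6 * (l' x * (l x)⁻¹)) x (inducedFrame E (ψ t) k x)
      = -6 * (mvfderiv (𝓡 3) l' x (E k x) - l' x * (l x)⁻¹ * mvfderiv (𝓡 3) l x (E k x)) := by
    intro k
    have h1 : inducedFrame E (ψ t) k x = l x • E k x := rfl
    have := h0 x
    rw [h1, map_smul, hdtr, smul_eq_mul]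
    field_simp
  rw [diracVariation, htr, hD]
  simp only [hfr, conformalDirac, Fin.sum_univ_three]
  have := h0 x
  match_scalars <;> field_simp <;> ring

end Flow

/-! ### The moving volume and the energy density -/

section Energy

variable {M : Type*} [TopologicalSpace M] [ChartedSpace Model M] [IsManifold (𝓡 3) ∞ M]
  [CompactSpace M] [MeasurableSpace M] [BorelSpace M]
  {T t : ℝ} {ψ : ℝ → M → Spinor} {g : FormField M} {E : Fin 3 → VField M}

theorem inducedVolume_eq (hE : ∀ x i j, g x (E i x) (E j x) = if i = j then 1 else 0)
    (hEs : ∀ k, ContMDiff (𝓡 3) ((𝓡 3).prod 𝓘(ℝ, Model)) ∞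
      (fun x => (⟨x, E k x⟩ : TangentBundle (𝓡 3) M)))
    (hψ : SmoothFamily T ψ) (hne : ∀ t ∈ Ioo 0 T, ∀ x, ψ t x ≠ 0) (ht : t ∈ Ioo 0 T) :
    inducedVolume g (ψ t)
      = (volumeMeasure g).withDensity fun x => ENNReal.ofReal (‖ψ t x‖ ^ 3) :=
  volumeMeasure_conformal hE hEs (r := fun x => ‖ψ t x‖) (fun x => norm_pos_iff.2 (hne t ht x))
    (hψ.continuous_slice ht).norm

theorem setIntegral_inducedVolume (hE : ∀ x i j, g x (E i x) (E j x) = if i = j then 1 else 0)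
    (hEs : ∀ k, ContMDiff (𝓡 3) ((𝓡 3).prod 𝓘(ℝ, Model)) ∞
      (fun x => (⟨x, E k x⟩ : TangentBundle (𝓡 3) M)))
    (hψ : SmoothFamily T ψ) (hne : ∀ t ∈ Ioo 0 T, ∀ x, ψ t x ≠ 0) (ht : t ∈ Ioo 0 T)
    {A : Set M} (hA : MeasurableSet A) (f : M → ℝ) :
    ∫ x in A, f x ∂(inducedVolume g (ψ t))
      = ∫ x in A, ‖ψ t x‖ ^ 3 * f x ∂(volumeMeasure g) := by
  have hm : Measurable fun x => ENNReal.ofReal (‖ψ t x‖ ^ 3) :=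
    ((hψ.continuous_slice ht).norm.pow 3).measurable.ennreal_ofReal
  rw [inducedVolume_eq hE hEs hψ hne ht, restrict_withDensity hA,
    integral_withDensity_eq_integral_toReal_smul hm (by simp)]
  simp only [ENNReal.toReal_ofReal (pow_nonneg (norm_nonneg _) 3), smul_eq_mul]

theorem integral_inducedVolume (hE : ∀ x i j, g x (E i x) (E j x) = if i = j then 1 else 0)
    (hEs : ∀ k, ContMDiff (𝓡 3) ((𝓡 3).prod 𝓘(ℝ, Model)) ∞
      (fun x => (⟨x, E k x⟩ : TangentBundle (𝓡 3) M)))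
    (hψ : SmoothFamily T ψ) (hne : ∀ t ∈ Ioo 0 T, ∀ x, ψ t x ≠ 0) (ht : t ∈ Ioo 0 T)
    (f : M → ℝ) :
    ∫ x, f x ∂(inducedVolume g (ψ t)) = ∫ x, ‖ψ t x‖ ^ 3 * f x ∂(volumeMeasure g) := by
  simpa using setIntegral_inducedVolume hE hEs hψ hne ht MeasurableSet.univ f

theorem integrable_inducedVolume [T2Space M]
    (hE : ∀ x i j, g x (E i x) (E j x) = if i = j then 1 else 0)
    (hEs : ∀ k, ContMDiff (𝓡 3) ((𝓡 3).prod 𝓘(ℝ, Model)) ∞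
      (fun x => (⟨x, E k x⟩ : TangentBundle (𝓡 3) M)))
    (hψ : SmoothFamily T ψ) (hne : ∀ t ∈ Ioo 0 T, ∀ x, ψ t x ≠ 0) (ht : t ∈ Ioo 0 T)
    {f : M → ℝ} (hf : Continuous f) : Integrable f (inducedVolume g (ψ t)) := by
  have hfin := isFiniteMeasure_volumeMeasure hE hEs
  have hint : Integrable (fun x => ‖ψ t x‖ ^ 3) (volumeMeasure g) :=
    ((hψ.continuous_slice ht).norm.pow 3).integrable_of_hasCompactSupport
      (HasCompactSupport.of_compactSpace _)
  have : IsFiniteMeasure (inducedVolume g (ψ t)) := by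
    rw [inducedVolume_eq hE hEs hψ hne ht]
    exact isFiniteMeasure_withDensity_ofReal hint.hasFiniteIntegral
  exact hf.integrable_of_hasCompactSupport (HasCompactSupport.of_compactSpace _)

/-- The volume of a Borel set varies by half of the trace of the velocity of the metric. -/
theorem hasDerivAt_inducedVolume_real [T2Space M]
    (hE : ∀ x i j, g x (E i x) (E j x) = if i = j then 1 else 0)
    (hEs : ∀ k, ContMDiff (𝓡 3) ((𝓡 3).prod 𝓘(ℝ, Model)) ∞
      (fun x => (⟨x, E k x⟩ : TangentBundle (𝓡 3) M)))
    (hψ : SmoothFamily T ψ) (hne : ∀ t ∈ Ioo 0 T, ∀ x, ψ t x ≠ 0) (ht : t ∈ Ioo 0 T)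
    {A : Set M} (hA : MeasurableSet A) :
    HasDerivAt (fun s => (inducedVolume g (ψ s)).real A)
      (∫ x in A, (1 / 2) * frameTrace (inducedFrame E (ψ t)) (metricVelocity g ψ t) x
        ∂(inducedVolume g (ψ t))) t := by
  have hfin := isFiniteMeasure_volumeMeasure hE hEs
  have hR := smoothFamily_norm hψ hne
  have hR3 : SmoothFamily T (fun s x => ‖ψ s x‖ ^ 3) :=
    hR.comp fun _ _ _ => (contDiff_id.pow 3).contDiffAt
  have h := hR3.hasDerivAt_integral ht ((volumeMeasure g).restrict A)
  have hval : ∀ s ∈ Ioo 0 T, (inducedVolume g (ψ s)).real A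
      = ∫ x in A, ‖ψ s x‖ ^ 3 ∂(volumeMeasure g) := by
    intro s hs
    have := setIntegral_inducedVolume hE hEs hψ hne hs hA (fun _ => (1 : ℝ))
    simpa using this
  refine (h.congr_deriv ?_).congr_of_eventuallyEq ?_
  · rw [setIntegral_inducedVolume hE hEs hψ hne ht hA]
    congr 1
    funext x
    rw [((hR.hasDerivAt ht x).fun_pow 3).deriv, frameTrace_metricVelocity hE hψ hne ht]
    have := norm_ne_zero_iff.2 (hne t ht x)
    field_simp
    norm_num
    ring
  · filter_upwards [isOpen_Ioo.mem_nhds ht] with s hs using hval s hs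

/-- The time derivative of the energy density with respect to the background volume. -/
theorem hasDerivAt_energyDensity {l : ℝ → M → ℝ} (hl : SmoothFamily T l)
    {R : ℝ → M → ℝ} (hR : SmoothFamily T R) (hψ : SmoothFamily T ψ) (ht : t ∈ Ioo 0 T) (x : M) :
    HasDerivAt (fun s => R s x ^ 3 * ‖conformalDirac g E (l s) (ψ s) x‖ ^ 2)
      (3 * R t x ^ 2 * deriv (fun s => R s x) t * ‖conformalDirac g E (l t) (ψ t) x‖ ^ 2
        + R t x ^ 3 * (2 * (inner ℂ (conformalDirac g E (fun y => deriv (fun s => l s y) t) (ψ t) x)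
          (conformalDirac g E (l t) (ψ t) x)).re)
        + 2 * (R t x ^ 3 * (inner ℂ (conformalDirac g E (l t) (fun y => deriv (fun s => ψ s y) t) x)
          (conformalDirac g E (l t) (ψ t) x)).re)) t := by
  have h := ((hR.hasDerivAt ht x).fun_pow 3).fun_mul
    (hasDerivAt_norm_sq (hasDerivAt_conformalDirac (g := g) (E := E) hl hψ ht x))
  refine h.congr_deriv ?_
  rw [inner_add_left, Complex.add_re]
  norm_num
  ring

end Energy

end SpinorFlow
end

/-! ### The energy evolution -/

theorem mainTheorem2 {M : Type*} [TopologicalSpace M] [ChartedSpace SpinorFlow.Model M]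
    [IsManifold (𝓡 3) ∞ M] [CompactSpace M] [T2Space M] [MeasurableSpace M] [BorelSpace M]
    -- the background metric and a global orthonormal frame
    (g₀ : Bundle.ContMDiffRiemannianMetric (𝓡 3) ∞ SpinorFlow.Model
      (fun x : M => TangentSpace (𝓡 3) x))
    (E : Fin 3 → SpinorFlow.VField M)
    (hE : ∀ k, ContMDiff (𝓡 3) ((𝓡 3).prod 𝓘(ℝ, SpinorFlow.Model)) ∞
      (fun x => (⟨x, E k x⟩ : TangentBundle (𝓡 3) M)))
    (hE_orth : ∀ x i j, g₀.inner x (E i x) (E j x) = if i = j then 1 else 0)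
    -- a smooth nowhere vanishing solution of the flow on `M × (0, T)`
    (T : ℝ) (ψ : ℝ → M → SpinorFlow.Spinor)
    (hψ : ContMDiffOn (𝓘(ℝ, ℝ).prod (𝓡 3)) 𝓘(ℝ, SpinorFlow.Spinor) ∞
      (fun p : ℝ × M => ψ p.1 p.2) (Ioo 0 T ×ˢ univ))
    (hψ_ne : ∀ t ∈ Ioo 0 T, ∀ x, ψ t x ≠ 0)
    (hflow : ∀ t ∈ Ioo 0 T, ∀ x, HasDerivAt (fun s => ψ s x)
      (-SpinorFlow.inducedDirac g₀.inner E (ψ t)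
        (SpinorFlow.inducedDirac g₀.inner E (ψ t) (ψ t)) x) t)
    (t : ℝ) (ht : t ∈ Ioo 0 T) :
    let g : SpinorFlow.FormField M := SpinorFlow.inducedMetric g₀.inner (ψ t)
    let e : Fin 3 → SpinorFlow.VField M := SpinorFlow.inducedFrame E (ψ t)
    let h := SpinorFlow.metricVelocity g₀.inner ψ t
    let D : (M → SpinorFlow.Spinor) → M → SpinorFlow.Spinor := SpinorFlow.dirac g e
    let dV : Measure M := SpinorFlow.volumeMeasure g
    -- all the integrals exist
    (Integrable (fun x => ‖D (ψ t) x‖ ^ 2) dV ∧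
      Integrable (fun x => ‖D (D (ψ t)) x‖ ^ 2) dV ∧
      Integrable (SpinorFlow.metricReaction g e h (ψ t)) dV ∧
      Integrable (SpinorFlow.volumeReaction g e h (ψ t)) dV) ∧
    -- the energy evolution
    HasDerivAt (fun s => SpinorFlow.energy g₀.inner E (ψ s))
      (-2 * (∫ x, ‖D (D (ψ t)) x‖ ^ 2 ∂dV) + SpinorFlow.reaction g e h (ψ t)) t ∧
    -- the metric varies by `h`, which is conformal
    (∀ x v w, HasDerivAt (fun s => SpinorFlow.inducedMetric g₀.inner (ψ s) x v w) (h x v w) t ∧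
      h x v w = SpinorFlow.frameTrace e h x / 3 * g x v w) ∧
    -- the Dirac operator, applied to a fixed spinor field, varies as in the reaction term
    (∀ φ : M → SpinorFlow.Spinor, ContMDiff (𝓡 3) 𝓘(ℝ, SpinorFlow.Spinor) ∞ φ → ∀ x,
      HasDerivAt (fun s => SpinorFlow.inducedDirac g₀.inner E (ψ s) φ x)
        (SpinorFlow.diracVariation g e h φ x) t) ∧
    -- the volume measure varies as in the reaction term
    (∀ A : Set M, MeasurableSet A →
      HasDerivAt (fun s => (SpinorFlow.inducedVolume g₀.inner (ψ s)).real A)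
        (∫ x in A, (1 / 2) * SpinorFlow.frameTrace e h x ∂dV) t) := by
  intro g e h D dV
  have hψ' : SpinorFlow.SmoothFamily T ψ := hψ
  have hc := SpinorFlow.contMDiff_structureCoeff g₀ hE
  have hR := SpinorFlow.smoothFamily_norm hψ' hψ_ne
  have hl := SpinorFlow.smoothFamily_norm_inv hψ' hψ_ne
  set l : ℝ → M → ℝ := fun s x => ‖ψ s x‖⁻¹ with hldef
  have hfin := SpinorFlow.isFiniteMeasure_volumeMeasure hE_orth hE
  have hint : ∀ {f : M → ℝ}, Continuous f →
      Integrable f (SpinorFlow.volumeMeasure (g₀.inner : SpinorFlow.FormField M)) := fun hf =>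
    hf.integrable_of_hasCompactSupport (HasCompactSupport.of_compactSpace _)
  have hDeq : ∀ s ∈ Ioo 0 T, ∀ φ, SpinorFlow.inducedDirac g₀.inner E (ψ s) φ
      = SpinorFlow.conformalDirac g₀.inner E (l s) φ := fun s hs φ =>
    SpinorFlow.inducedDirac_eq hE_orth hE hψ' hψ_ne hs φ
  have hD : ∀ φ, D φ = SpinorFlow.conformalDirac g₀.inner E (l t) φ := hDeq t ht
  have hvar : ∀ φ, SpinorFlow.diracVariation g e h φ
      = SpinorFlow.conformalDirac g₀.inner E (fun x => deriv (fun s => l s x) t) φ :=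
    SpinorFlow.diracVariation_eq hE_orth hE hψ' hψ_ne ht
  have htr : ∀ x, SpinorFlow.frameTrace e h x = 6 * deriv (fun s => ‖ψ s x‖) t / ‖ψ t x‖ :=
    SpinorFlow.frameTrace_metricVelocity hE_orth hψ' hψ_ne ht
  have hn : ∀ x, ‖ψ t x‖ ≠ 0 := fun x => norm_ne_zero_iff.2 (hψ_ne t ht x)
  -- smoothness of the fields involved
  have hP := hl.conformalDirac hψ' hE_orth hE hc
  have hPP := hl.conformalDirac hP hE_orth hE hc
  have hV := hl.deriv.conformalDirac hψ' hE_orth hE hc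
  have hDψ' := hl.conformalDirac hψ'.deriv hE_orth hE hc
  have cP := hP.continuous_slice ht
  have cPP := hPP.continuous_slice ht
  have cV := hV.continuous_slice ht
  have cR := hR.continuous_slice ht
  have cR' := hR.deriv.continuous_slice ht
  have hmr : ∀ x, SpinorFlow.metricReaction g e h (ψ t) x
      = 2 * (inner ℂ (SpinorFlow.conformalDirac g₀.inner E (fun x => deriv (fun s => l s x) t)
        (ψ t) x) (SpinorFlow.conformalDirac g₀.inner E (l t) (ψ t) x)).re := by
    intro x
    rw [← hvar, ← hD]
    rfl
  have hvr : ∀ x, SpinorFlow.volumeReaction g e h (ψ t) x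
      = 3 * deriv (fun s => ‖ψ s x‖) t / ‖ψ t x‖
        * ‖SpinorFlow.conformalDirac g₀.inner E (l t) (ψ t) x‖ ^ 2 := by
    intro x
    rw [← hD, SpinorFlow.volumeReaction, htr]
    ring
  have cmr : Continuous (SpinorFlow.metricReaction g e h (ψ t)) := by
    rw [funext hmr]
    exact continuous_const.mul (Complex.continuous_re.comp (cV.inner cP))
  have cvr : Continuous (SpinorFlow.volumeReaction g e h (ψ t)) := by
    rw [funext hvr]
    exact ((continuous_const.mul cR').div cR hn).mul (cP.norm.pow 2)
  have cDD : Continuous fun x => ‖D (D (ψ t)) x‖ ^ 2 := by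
    simp only [hD]
    exact cPP.norm.pow 2
  have hintV : ∀ {f : M → ℝ}, Continuous f → Integrable f dV := fun hf =>
    SpinorFlow.integrable_inducedVolume hE_orth hE hψ' hψ_ne ht hf
  have hintegral : ∀ f : M → ℝ, ∫ x, f x ∂dV
      = ∫ x, ‖ψ t x‖ ^ 3 * f x ∂(SpinorFlow.volumeMeasure g₀.inner) :=
    SpinorFlow.integral_inducedVolume hE_orth hE hψ' hψ_ne ht
  refine ⟨⟨hintV ?_, hintV cDD, hintV cmr, hintV cvr⟩, ?_, ?_, ?_, ?_⟩
  · simp only [hD]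
    exact cP.norm.pow 2
  -- The energy density is taken relative to the background volume, so that only the integrand
  -- depends on time.
  · have hfam : SpinorFlow.SmoothFamily T (fun s x => ‖ψ s x‖ ^ 3 *
        ‖SpinorFlow.conformalDirac g₀.inner E (l s) (ψ s) x‖ ^ 2) :=
      (hR.prodMk hP).comp fun _ _ _ =>
        ((contDiff_fst.pow 3).mul (contDiff_snd.norm_sq ℂ)).contDiffAt
    have hder := hfam.hasDerivAt_integral ht (SpinorFlow.volumeMeasure g₀.inner)
    refine (hder.congr_deriv ?_).congr_of_eventuallyEq ?_
    · have hψt : (fun y => deriv (fun s => ψ s y) t)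
          = fun y => -SpinorFlow.conformalDirac g₀.inner E (l t)
            (SpinorFlow.conformalDirac g₀.inner E (l t) (ψ t)) y := by
        funext y
        rw [(hflow t ht y).deriv, hDeq t ht, hDeq t ht]
      -- Symmetry, applied to `∂ₜψ` and `Dψ`, moves `D` off the time derivative; by `hself` the
      -- result is `-∫ |D²ψ|²`.
      have hsymm := SpinorFlow.integral_re_inner_conformalDirac hE_orth hE hc (hl.slice ht)
        (fun x => inv_ne_zero (hn x)) (hψ'.deriv.slice ht) (hP.slice ht)
      rw [SpinorFlow.reaction, hintegral, hintegral, hintegral]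
      simp only [hmr, hvr, hD]
      simp only [(SpinorFlow.hasDerivAt_energyDensity (g := g₀.inner) (E := E) hl hR hψ' ht _).deriv]
      have hself : ∀ x, (inner ℂ (deriv (fun s => ψ s x) t) (SpinorFlow.conformalDirac g₀.inner E
          (l t) (SpinorFlow.conformalDirac g₀.inner E (l t) (ψ t)) x)).re
          = -‖SpinorFlow.conformalDirac g₀.inner E (l t)
            (SpinorFlow.conformalDirac g₀.inner E (l t) (ψ t)) x‖ ^ 2 := by
        intro x
        rw [congrFun hψt x, inner_neg_left, Complex.neg_re,
          ← inner_self_eq_norm_sq (𝕜 := ℂ)]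
        rfl
      simp only [hldef, inv_inv] at hsymm hself
      simp only [hself] at hsymm
      have hkin : Integrable (fun x => 3 * ‖ψ t x‖ ^ 2 * deriv (fun s => ‖ψ s x‖) t *
          ‖SpinorFlow.conformalDirac g₀.inner E (l t) (ψ t) x‖ ^ 2)
          (SpinorFlow.volumeMeasure (g₀.inner : SpinorFlow.FormField M)) :=
        hint (((continuous_const.mul (cR.pow 2)).mul cR').mul (cP.norm.pow 2))
      have hmet : Integrable (fun x => ‖ψ t x‖ ^ 3 * (2 * (inner ℂ
          (SpinorFlow.conformalDirac g₀.inner E (fun y => deriv (fun s => l s y) t) (ψ t) x)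
          (SpinorFlow.conformalDirac g₀.inner E (l t) (ψ t) x)).re))
          (SpinorFlow.volumeMeasure (g₀.inner : SpinorFlow.FormField M)) :=
        hint ((cR.pow 3).mul (continuous_const.mul (Complex.continuous_re.comp (cV.inner cP))))
      have hdiss : Integrable (fun x => 2 * (‖ψ t x‖ ^ 3 * (inner ℂ
          (SpinorFlow.conformalDirac g₀.inner E (l t) (fun y => deriv (fun s => ψ s y) t) x)
          (SpinorFlow.conformalDirac g₀.inner E (l t) (ψ t) x)).re))
          (SpinorFlow.volumeMeasure (g₀.inner : SpinorFlow.FormField M)) :=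
        hint (continuous_const.mul ((cR.pow 3).mul
          (Complex.continuous_re.comp ((hDψ'.continuous_slice ht).inner cP))))
      -- Weighted by `ρ³`, the volume reaction is the term coming from the derivative of `ρ³`.
      have hkin_eq : ∀ x, ‖ψ t x‖ ^ 3 * (3 * deriv (fun s => ‖ψ s x‖) t / ‖ψ t x‖
          * ‖SpinorFlow.conformalDirac g₀.inner E (l t) (ψ t) x‖ ^ 2)
          = 3 * ‖ψ t x‖ ^ 2 * deriv (fun s => ‖ψ s x‖) t *
          ‖SpinorFlow.conformalDirac g₀.inner E (l t) (ψ t) x‖ ^ 2 := by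
        intro x
        have := hn x
        field_simp
      simp only [hkin_eq]
      refine (integral_add (hkin.add hmet) hdiss).trans ?_
      refine (congrArg₂ (· + ·) (integral_add hkin hmet)
        ((integral_const_mul _ _).trans (congrArg (2 * ·) hsymm))).trans ?_
      simp only [mul_neg, integral_neg]
      ring
    -- The background formula for the energy holds for times in `(0, T)`, hence near `t`.
    · filter_upwards [isOpen_Ioo.mem_nhds ht] with s hs
      rw [SpinorFlow.energy, SpinorFlow.integral_inducedVolume hE_orth hE hψ' hψ_ne hs,
        hDeq s hs]
  · intro x v w
    refine ⟨(SpinorFlow.hasDerivAt_inducedMetric hψ' hψ_ne ht x v w).congr_deriv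
      (SpinorFlow.metricVelocity_eq hψ' hψ_ne ht x v w).symm, ?_⟩
    rw [htr]
    refine (SpinorFlow.metricVelocity_eq hψ' hψ_ne ht x v w).trans ?_
    change _ = _ / 3 * (‖ψ t x‖ ^ 2 * g₀.inner x v w)
    have := hn x
    field_simp
    ring
  · intro φ hφ x
    have hder := SpinorFlow.hasDerivAt_conformalDirac (g := g₀.inner) (E := E) hl
      (SpinorFlow.SmoothFamily.const_time (T := T) hφ) ht x
    rw [hvar]
    refine (hder.congr_deriv ?_).congr_of_eventuallyEq ?_
    -- Since `φ` is constant in time, the second product rule term is the operator applied to zero.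
    · simp [SpinorFlow.conformalDirac, SpinorFlow.dirac_eq, mvfderiv_const]
    · filter_upwards [isOpen_Ioo.mem_nhds ht] with s hs
      rw [hDeq s hs]
  · intro A hA
    exact SpinorFlow.hasDerivAt_inducedVolume_real hE_orth hE hψ' hψ_ne ht hA
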